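/- Let $(R,\mathfrak m)$ be a (Noetherian) Cohen–Macaulay local ring of dimension one, let $I\subsetneq R$ be a canonical ideal of $R$ (an ideal isomorphic, as an $R$-module, to the canonical module $\mathrm K_R$), and suppose that $I$ contains a parameter ideal $Q=(a)$ which is a reduction of $I$, i.e. $a\in I$ is a nonzerodivisor and $I^{n+1}=QI^n$ for some $n\ge 0$. Put $K=\{x/a \mid x\in I\}$ in the total ring of fractions $\mathrm Q(R)$ and $B=\mathfrak m:\mathfrak m=\{x\in \mathrm Q(R)\mid x\mathfrak m\subseteq\mathfrak m\}$. A one-dimensional Cohen–Macaulay local ring $(A,\mathfrak n)$ is called AGL (almost Gorenstein local) if it possesses a canonical module $\mathrm K_A$ and there is an exact sequence $0\to A\to \mathrm K_A\to C\to 0$ of $A$-modules with $\mathfrak n C=0$. The ring $R$ is called 2-AGL if the Sally module $\mathcal S_Q(I)=I\mathcal R/I\mathcal T$, where $\mathcal T=R[Qt]\subseteq\mathcal R=R[It]\subseteq R[t]$, has rank two, i.e. $\ell_{\mathcal T_{\mathfrak p}}(\mathcal S_Q(I)_{\mathfrak p})=2$ for $\mathfrak p=\mathfrak m\mathcal T$.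 **Theorem.** Suppose that $R$ is 2-AGL and that $\mathfrak m^2=\alpha\mathfrak m$ for some $\alpha\in\mathfrak m$. Set $L=BK$. Then: 1. $\ell_R(L^2/L)=1$. 2. Let $M=(0):_B(L^2/L)$. Then $M$ is a maximal ideal of $B$, $R/\mathfrak m\cong B/M$ (as $R$-algebras), and $B_M$ is an AGL ring which is not a Gorenstein ring. 3. If $N$ is a maximal ideal of $B$ with $N\neq M$, then $B_N$ is a Gorenstein ring. Therefore $B_N$ is an AGL ring for every maximal ideal $N$ of $B$. -/

import Mathlib

open CategoryTheory
open scoped nonZeroDivisors Pointwise Polynomial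

universe u

noncomputable section

namespace TwoAGL

/-! ### Cohen-Macaulay and Gorenstein local rings, canonical modules -/

/-- A finitely generated module `C` over a local ring `A` is *maximal Cohen-Macaulay* if the
maximal ideal contains a `C`-regular sequence whose length is `dim A`. -/
structure IsMaximalCohenMacaulay (A : Type u) [CommRing A] [IsLocalRing A]
    (C : Type u) [AddCommGroup C] [Module A C] : Prop where
  finite : Module.Finite A C
  exists_regular : ∃ rs : List A, (∀ r ∈ rs, r ∈ IsLocalRing.maximalIdeal A) ∧
    RingTheory.Sequence.IsRegular C rs ∧ ringKrullDim A = (rs.length : WithBot ℕ∞)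

/-- A Cohen-Macaulay local ring. -/
structure IsCohenMacaulayLocalRing (A : Type u) [CommRing A] [IsLocalRing A] : Prop where
  noetherian : IsNoetherianRing A
  maximal : IsMaximalCohenMacaulay A A

/-- A Gorenstein local ring: a Noetherian local ring of finite injective dimension over itself. -/
structure IsGorensteinLocalRing (A : Type u) [CommRing A] [IsLocalRing A] : Prop where
  noetherian : IsNoetherianRing A
  injective_dim : ∃ n : ℕ, HasInjectiveDimensionLE (ModuleCat.of A A) n

/-- `C` is a *canonical module* of the Cohen-Macaulay local ring `A` with residue field `k`: a
maximal Cohen-Macaulay module of finite injective dimension and of type one, that is,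
`Ext^d_A(k, C)` has length one for `d = dim A`. -/
structure IsCanonicalModule (A : Type u) [CommRing A] [IsLocalRing A]
    (C : Type u) [AddCommGroup C] [Module A C] : Prop where
  maximal : IsMaximalCohenMacaulay A C
  injective_dim : ∃ n : ℕ, HasInjectiveDimensionLE (ModuleCat.of A C) n
  type_one : ∃ d : ℕ, ringKrullDim A = (d : WithBot ℕ∞) ∧
    Module.length A (Abelian.Ext.{u} (ModuleCat.of A (IsLocalRing.ResidueField A))
      (ModuleCat.of A C) d) = 1

/-- An *almost Gorenstein local (AGL) ring* of dimension one: a one-dimensional Cohen-Macaulay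
local ring `A` with a canonical module `C` and an exact sequence `0 → A → C → C / A → 0` whose
cokernel is annihilated by the maximal ideal. -/
structure IsAGL (A : Type u) [CommRing A] [IsLocalRing A] : Prop where
  cohenMacaulay : IsCohenMacaulayLocalRing A
  dim_one : ringKrullDim A = 1
  exists_sequence : ∃ (C : ModuleCat.{u} A) (f : A →ₗ[A] C), IsCanonicalModule A C ∧
    Function.Injective f ∧
      IsLocalRing.maximalIdeal A ≤ Module.annihilator A (C ⧸ LinearMap.range f)

/-! ### The Sally module and 2-AGL rings -/

section Sally

variable {R : Type u} [CommRing R]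

/-- For ideals `I`, `Q`, `P` of `R` with `Q ⊆ P`, the set `I 𝓡(P) ⊆ R[t]` as a module over
`𝓡(Q) = R[Qt]`. (The span of `𝓡(P)` over `𝓡(Q)` is `𝓡(P)` itself, since `Q ⊆ P`.) -/
def mulRees (I Q P : Ideal R) : Submodule (reesAlgebra Q) R[X] :=
  I.map (algebraMap R (reesAlgebra Q)) •
    Submodule.span (reesAlgebra Q) (reesAlgebra P : Set R[X])

/-- The Sally module `I 𝓡(I) / I 𝓡(Q)` of `I` with respect to `Q ⊆ I`, as a module over
`𝓡(Q)`: the image of `I 𝓡(I)` in `R[t] / I 𝓡(Q)`. -/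
abbrev SallyModule (I Q : Ideal R) : Type u :=
  ↥((mulRees I Q I).map (mulRees I Q Q).mkQ)

variable [IsLocalRing R]

/-- The ideal `𝔪 𝓣` of `𝓣 = 𝓡(Q)`. -/
abbrev sallyPrime (Q : Ideal R) : Ideal (reesAlgebra Q) :=
  (IsLocalRing.maximalIdeal R).map (algebraMap R (reesAlgebra Q))

/-- If `Q` is generated by a nonzerodivisor, then `𝓡(Q)` is a polynomial ring in one variable over
`R`, and therefore `𝔪 𝓡(Q)` is prime. -/
theorem sallyPrime_isPrime {a : R} (ha : a ∈ R⁰) : (sallyPrime (Ideal.span {a})).IsPrime := by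
  have hT : (Polynomial.aeval (Polynomial.monomial 1 a) : R[X] →ₐ[R] R[X]).range =
      reesAlgebra (Ideal.span {a}) := by
    rw [← adjoin_monomial_eq_reesAlgebra, Ideal.span, Submodule.map_span, Set.image_singleton,
      Algebra.adjoin_span, Algebra.adjoin_singleton_eq_range_aeval]
  have hinj : Function.Injective
      (Polynomial.aeval (Polynomial.monomial 1 a) : R[X] →ₐ[R] R[X]) := by
    rw [injective_iff_map_eq_zero]
    intro f hf
    ext n
    have h1 : f.comp (Polynomial.C a * Polynomial.X) = 0 := by
      rw [Polynomial.C_mul_X_eq_monomial, ← hf]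
      rfl
    have h2 := congrArg (fun g => Polynomial.coeff g n) h1
    simp only [Polynomial.comp_C_mul_X_coeff, Polynomial.coeff_zero] at h2
    rw [Polynomial.coeff_zero]
    exact (mul_right_mem_nonZeroDivisors_eq_zero_iff (pow_mem ha n)).1 h2
  let e : R[X] ≃ₐ[R] reesAlgebra (Ideal.span {a}) :=
    (AlgEquiv.ofInjective _ hinj).trans (Subalgebra.equivOfEq _ _ hT)
  have he : ((e : R[X] ≃+* reesAlgebra (Ideal.span {a})) : R[X] →+* _).comp Polynomial.C =
      algebraMap R (reesAlgebra (Ideal.span {a})) := by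
    ext r : 1
    exact e.commutes r
  have hp : ((IsLocalRing.maximalIdeal R).map (Polynomial.C : R →+* R[X])).IsPrime :=
    Ideal.isPrime_map_C_of_isPrime
  rw [sallyPrime, ← he, ← Ideal.map_map]
  exact Ideal.map_isPrime_of_equiv (e : R[X] ≃+* reesAlgebra (Ideal.span {a}))

/-- The rank of the Sally module of `I` with respect to `Q = (a)`: the length over `𝓣_𝔭` of the
localization at `𝔭 = 𝔪 𝓣`, where `𝓣 = 𝓡(Q)`. -/
def sallyRank (I : Ideal R) {a : R} (ha : a ∈ R⁰) : ℕ∞ :=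
  haveI := sallyPrime_isPrime ha
  Module.length (Localization.AtPrime (sallyPrime (Ideal.span {a})))
    (LocalizedModule (sallyPrime (Ideal.span {a})).primeCompl (SallyModule I (Ideal.span {a})))

/-- `R` is a *2-almost Gorenstein local (2-AGL) ring*, with respect to the canonical ideal `I` and
its reduction `Q = (a)`: the Sally module of `I` with respect to `Q` has rank two. -/
def IsTwoAGL (I : Ideal R) {a : R} (ha : a ∈ R⁰) : Prop :=
  sallyRank I ha = 2

end Sally

/-! ### The setting -/

/-- `(a)` is a parameter ideal of the one-dimensional Cohen-Macaulay local ring `R` which is a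
reduction of the canonical ideal `I` of `R`. (As `a` belongs to the proper ideal `I`, the ideal
`(a)` is a parameter ideal if and only if `a` is a nonzerodivisor.) -/
structure Setting (R : Type u) [CommRing R] [IsLocalRing R] (I : Ideal R) (a : R) : Prop where
  cohenMacaulay : IsCohenMacaulayLocalRing R
  dim_one : ringKrullDim R = 1
  ne_top : I ≠ ⊤
  canonical : IsCanonicalModule R I
  mem : a ∈ I
  regular : a ∈ R⁰
  reduction : ∃ n : ℕ, I ^ (n + 1) = Ideal.span {a} * I ^ n

section Fractional

variable {R : Type u} [CommRing R] (F : Type u) [CommRing F] [Algebra R F] [IsFractionRing R F]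

/-- `K = I / a = {x / a | x ∈ I}` in the total ring of fractions `F` of `R`. -/
def fractionalK (I : Ideal R) {a : R} (ha : a ∈ R⁰) : Submodule R F :=
  IsLocalization.mk' F (1 : R) (⟨a, ha⟩ : R⁰) •
    Submodule.map (Algebra.linearMap R F) I

theorem mem_fractionalK (I : Ideal R) {a : R} (ha : a ∈ R⁰) (z : F) :
    z ∈ fractionalK F I ha ↔ ∃ x ∈ I, z = IsLocalization.mk' F x (⟨a, ha⟩ : R⁰) := by
  simp only [fractionalK, Submodule.mem_smul_pointwise_iff_exists, Submodule.mem_map]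
  constructor
  · rintro ⟨_, ⟨x, hx, rfl⟩, rfl⟩
    refine ⟨x, hx, ?_⟩
    rw [smul_eq_mul, mul_comm, Algebra.linearMap_apply, IsLocalization.mul_mk'_eq_mk'_of_mul,
      mul_one]
  · rintro ⟨x, hx, rfl⟩
    refine ⟨_, ⟨x, hx, rfl⟩, ?_⟩
    rw [smul_eq_mul, mul_comm, Algebra.linearMap_apply, IsLocalization.mul_mk'_eq_mk'_of_mul,
      mul_one]

/-- For an ideal `J` of `R`, the algebra `J : J = {x ∈ F | x J ⊆ J}`. -/
def colonAlgebra (J : Ideal R) : Subalgebra R F where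
  carrier := {x | ∀ y ∈ J, ∃ z ∈ J, x * algebraMap R F y = algebraMap R F z}
  mul_mem' := by
    rintro x x' hx hx' y hy
    obtain ⟨z, hz, h⟩ := hx' y hy
    obtain ⟨w, hw, h'⟩ := hx z hz
    exact ⟨w, hw, by rw [mul_assoc, h, h']⟩
  add_mem' := by
    rintro x x' hx hx' y hy
    obtain ⟨z, hz, h⟩ := hx y hy
    obtain ⟨w, hw, h'⟩ := hx' y hy
    exact ⟨z + w, J.add_mem hz hw, by rw [add_mul, h, h', map_add]⟩
  algebraMap_mem' r y hy := ⟨r * y, J.mul_mem_left r hy, by rw [map_mul]⟩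

variable [IsLocalRing R]

/-- `B = 𝔪 : 𝔪`. -/
abbrev algB : Subalgebra R F := colonAlgebra F (IsLocalRing.maximalIdeal R)

/-- `L = B K`, a `B`-submodule of `F`. -/
def moduleL (I : Ideal R) {a : R} (ha : a ∈ R⁰) : Submodule (algB (R := R) F) F :=
  Submodule.span (algB (R := R) F) (fractionalK F I ha : Set F)

/-- The `B`-module `L² / L`. (It is `L ⊆ L²`, as `1 ∈ K`.) -/
abbrev QuotL (I : Ideal R) {a : R} (ha : a ∈ R⁰) : Type u :=
  ↥(moduleL F I ha ^ 2) ⧸ (moduleL F I ha).submoduleOf (moduleL F I ha ^ 2)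

/-- `M = (0) :_B (L² / L)`. -/
def idealM (I : Ideal R) {a : R} (ha : a ∈ R⁰) : Ideal (algB (R := R) F) :=
  Module.annihilator (algB (R := R) F) (QuotL F I ha)

end Fractional

end TwoAGL

end

/-! Write `F` for the total ring of fractions, `S = R[K]`, `L = BK`, and `X : Y` for the colon in
`F` (in the code `X / Y`). Three facts carry the proof.

Rank. The reduction equation gives `S = K ^ n`. Up to elements killed by `(at) ^ n`, which lies
outside `𝔪𝓣`, the Sally module is `𝓣 ⊗ S/K`. Its rank is therefore the length of `S/K`
(`sallyRank_eq_relLength`), and 2-AGL means `ℓ(S/K) = 2`.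

Duality. `K` is used only through `IsDualizing`: `F` and `F/K` are injective and `F/K` has simple
socle. This yields `K : (K : J) = J` for finitely generated `J`. From `𝔪² = α𝔪` it follows that `B =
α⁻¹𝔪`, and hence `L = K : 𝔪 = α⁻¹(K : B)` (`mem_spanB_iff`, `mem_spanB_iff_forall_mul`).
Consequently `L : L = B`, `F/L` is injective over `B`, and its `N`-socle is cyclic and nonzero for
each maximal `N`. Thus `L_N` is a canonical module of `B_N` (`isCanonicalModule_locSpanB`).

Squeezing. `L/K` is the simple socle of `F/K`, so `K ⊊ L ⊆ S` with both steps of length one. If `L²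
= L`, then `L` would be a ring containing `K`, hence contain `S`; therefore `L² = S` and `ℓ(L²/L) =
1`. So `M = ann(L²/L)` is maximal with residue field `R/𝔪`. Moreover `ML · L ⊆ L` gives `ML ⊆ L : L
= B`, and Nakayama sharpens this to `ML ⊆ M` (`mul_mem_annB`).

For `N ≠ M` this makes `B_N = L_N`, so `B_N` is Gorenstein. At `M` the inclusion `B_M ⊆ L_M` has
cokernel killed by the maximal ideal, so `B_M` is AGL, and it is proper because `L² ≠ L`. A
Gorenstein `B_M` would force equality (`surjective_of_isGorensteinLocalRing`). -/

set_option linter.unusedSectionVars false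

noncomputable section

namespace TwoAGL

/-! ### Ext groups over a local ring with a nonzerodivisor of finite colength -/

section Ext

open CategoryTheory.Abelian

variable {A : Type u} [CommRing A]

/-- On `Ext X Y`, multiplication by `b` is zero when computed through `X` and invertible when
computed through `Y`. -/
theorem ext_eq_zero_of_smul (b : A) {X Y : ModuleCat.{u} A} (hX : ∀ x : X, b • x = 0)
    (hY : Function.Bijective fun y : Y => b • y) {n : ℕ} (e : Ext.{u} X Y n) : e = 0 := by
  have h0 : b • (𝟙 X) = 0 := by
    ext x
    exact hX x
  have h1 : b • e = 0 := by
    rw [← Ext.mk₀_id_comp e, ← Ext.smul_comp, ← Ext.mk₀_smul, h0, Ext.mk₀_zero, Ext.zero_comp]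
  have hf : IsIso (b • (𝟙 Y)) := by
    rw [ConcreteCategory.isIso_iff_bijective]
    exact hY
  rw [Ext.smul_eq_comp_mk₀] at h1
  have h2 : (e.comp (Ext.mk₀ (b • 𝟙 Y)) (add_zero n)).comp (Ext.mk₀ (inv (b • 𝟙 Y))) (add_zero n)
      = e := by
    rw [Ext.comp_assoc_of_third_deg_zero, Ext.mk₀_comp_mk₀, IsIso.hom_inv_id, Ext.comp_mk₀_id]
  rw [← h2, h1, Ext.zero_comp]

/-- The connecting homomorphism of the second variable is bijective if the `Ext` groups of the
middle term vanish. -/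
def homEquivExtOne {S : ShortComplex (ModuleCat.{u} A)} (hS : S.ShortExact) (X : ModuleCat.{u} A)
    (h0 : ∀ e : Ext.{u} X S.X₂ 0, e = 0) (h1 : ∀ e : Ext.{u} X S.X₂ 1, e = 0) :
    (X →ₗ[A] S.X₃) ≃ₗ[A] Ext.{u} X S.X₁ 1 :=
  let φ : Ext.{u} X S.X₃ 0 →ₗ[A] Ext.{u} X S.X₁ 1 :=
    { toFun x := x.comp hS.extClass (zero_add 1)
      map_add' x y := by simp
      map_smul' r x := by simp }
  ((ModuleCat.homLinearEquiv (S := A)).symm.trans Ext.linearEquiv₀.symm).trans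
    (LinearEquiv.ofBijective φ (by
      constructor
      · rw [injective_iff_map_eq_zero]
        intro x hx
        obtain ⟨y, rfl⟩ := Ext.covariant_sequence_exact₃ X hS x (zero_add 1) hx
        rw [h0 y, Ext.zero_comp]
      · intro x
        exact Ext.covariant_sequence_exact₁ X hS x (h1 _) (zero_add 1)))

/-- If `0 → C → Q → E → 0` is exact and an element of the annihilator of `X` acts bijectively on
`Q`, then `Ext¹(X, C) ≅ Hom(X, E)`. -/
theorem length_ext_one (b : A) {X C Q E : Type u} [AddCommGroup X] [Module A X]
    [AddCommGroup C] [Module A C] [AddCommGroup Q] [Module A Q]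
    [AddCommGroup E] [Module A E] (f : C →ₗ[A] Q) (g : Q →ₗ[A] E) (hf : Function.Injective f)
    (hfg : Function.Exact f g) (hg : Function.Surjective g)
    (hX : ∀ x : X, b • x = 0) (hQ : Function.Bijective fun y : Q => b • y) :
    Module.length A (Ext.{u} (ModuleCat.of A X) (ModuleCat.of A C) 1) =
      Module.length A (X →ₗ[A] E) := by
  let S : ShortComplex (ModuleCat.{u} A) :=
    ModuleCat.shortComplexOfCompEqZero f g hfg.linearMap_comp_eq_zero
  have hS : S.ShortExact := ModuleCat.shortComplex_shortExact _ hfg hf hg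
  exact (homEquivExtOne hS (ModuleCat.of A X)
    (ext_eq_zero_of_smul b (Y := ModuleCat.of A Q) hX hQ)
    (ext_eq_zero_of_smul b (Y := ModuleCat.of A Q) hX hQ)).length_eq.symm

theorem hasInjectiveDimensionLE_one {C Q E : Type u} [AddCommGroup C] [Module A C]
    [AddCommGroup Q] [Module A Q] [AddCommGroup E] [Module A E] (f : C →ₗ[A] Q) (g : Q →ₗ[A] E)
    (hf : Function.Injective f) (hfg : Function.Exact f g) (hg : Function.Surjective g)
    [Module.Injective A Q] [Module.Injective A E] :
    HasInjectiveDimensionLE (ModuleCat.of A C) 1 := by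
  let S : ShortComplex (ModuleCat.{u} A) :=
    ModuleCat.shortComplexOfCompEqZero f g hfg.linearMap_comp_eq_zero
  have hS : S.ShortExact := ModuleCat.shortComplex_shortExact _ hfg hf hg
  have h2 : Injective S.X₂ := Module.injective_object_of_injective_module A Q
  have h3 : Injective S.X₃ := Module.injective_object_of_injective_module A E
  exact hS.hasInjectiveDimensionLT_X₁ 1 inferInstance inferInstance

variable [IsLocalRing A]

open IsLocalRing in
/-- In a local ring with a nonzerodivisor `b` such that `A / b` has finite length, `Ext^i(N, C)`
vanishes for `i ≥ 2` if `N` has finite length and `C` has finite injective dimension. -/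
theorem ext_eq_zero_of_hasInjectiveDimensionLT {b : A} (hb : b ∈ A⁰)
    (hbm : b ∈ maximalIdeal A) (hfin : IsFiniteLength A (A ⧸ Ideal.span {b}))
    (C : ModuleCat.{u} A) (n : ℕ) [HasInjectiveDimensionLT C n] (i : ℕ) (hi : 2 ≤ i)
    (N : Type u) [AddCommGroup N] [Module A N] (hN : IsFiniteLength A N)
    (e : Ext.{u} (ModuleCat.of A N) C i) : e = 0 := by
  have hpd : HasProjectiveDimensionLT (ModuleCat.of A (A ⧸ Ideal.span {b})) 2 := by
    let S : ShortComplex (ModuleCat.{u} A) :=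
      ModuleCat.shortComplexOfCompEqZero (LinearMap.lsmul A A b) (Ideal.span {b}).mkQ (by
        ext
        simp)
    have hS : S.ShortExact := by
      apply ModuleCat.shortComplex_shortExact
      · intro x
        change (Ideal.span {b}).mkQ x = 0 ↔ ∃ y : A, b * y = x
        rw [Submodule.mkQ_apply, Submodule.Quotient.mk_eq_zero, Ideal.mem_span_singleton']
        simp only [mul_comm]
      · intro x y h
        exact (mul_cancel_left_mem_nonZeroDivisors hb).1 h
      · exact Submodule.mkQ_surjective _
    have h1 : HasProjectiveDimensionLT S.X₁ 1 :=
      inferInstanceAs (HasProjectiveDimensionLT (ModuleCat.of A A) 1)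
    have h2 : HasProjectiveDimensionLT S.X₂ 2 :=
      inferInstanceAs (HasProjectiveDimensionLT (ModuleCat.of A A) 2)
    exact hS.hasProjectiveDimensionLT_X₃ 1 h1 h2
  -- Descending induction on the degree `i`: above the injective dimension of `C` all Ext groups
  -- vanish, and `k` bounds the distance to that range.
  obtain ⟨k, hk⟩ : ∃ k, n ≤ i + k := ⟨n, by omega⟩
  induction k generalizing i N with
  | zero => exact e.eq_zero_of_hasInjectiveDimensionLT n hk
  | succ k ih =>
    have ih' := fun N [AddCommGroup N] [Module A N] hN e =>
      ih (i + 1) (by omega) N hN e (by omega)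
    clear ih
    revert e
    induction hN with
    | @of_subsingleton M =>
      intro e
      have := (ModuleCat.isZero_of_subsingleton (ModuleCat.of A M)).hasProjectiveDimensionLT_zero
      exact e.eq_zero_of_hasProjectiveDimensionLT 0 (Nat.zero_le _)
    | @of_simple_quotient M _ _ N hs hN ihN =>
      intro e
      let S : ShortComplex (ModuleCat.{u} A) :=
        ModuleCat.shortComplexOfCompEqZero N.subtype N.mkQ (by ext; simp)
      have hS : S.ShortExact := by
        apply ModuleCat.shortComplex_shortExact
        · exact LinearMap.exact_subtype_mkQ N
        · exact N.injective_subtype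
        · exact N.mkQ_surjective
      obtain ⟨e', rfl⟩ := Ext.contravariant_sequence_exact₂ hS _ e (ihN _)
      -- Only the simple quotient `M ⧸ N` is left. It embeds into `A/(b)`, whose projective
      -- dimension is at most one, so `Ext^i(A/(b), C) = 0` for `i ≥ 2`; the cokernel has finite
      -- length and is handled by the induction in degree `i + 1`.
      suffices e' = 0 by rw [this, Ext.comp_zero]
      have hnt : Nontrivial (A ⧸ Ideal.span {b}) := by
        rw [Ideal.Quotient.nontrivial_iff]
        intro h
        rw [Ideal.span_singleton_eq_top] at h
        exact hbm h
      obtain ⟨hnoe, hart⟩ := isFiniteLength_iff_isNoetherian_isArtinian.1 hfin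
      obtain ⟨T, hT, -⟩ := (IsAtomic.eq_bot_or_exists_atom_le
        (⊤ : Submodule A (A ⧸ Ideal.span {b}))).resolve_left top_ne_bot
      have hT' : IsSimpleModule A T := isSimpleModule_iff_isAtom.2 hT
      obtain ⟨m₁, hm₁, ⟨e₁⟩⟩ := isSimpleModule_iff_quot_maximal.1 hT'
      obtain ⟨m₂, hm₂, ⟨e₂⟩⟩ := isSimpleModule_iff_quot_maximal.1 hs
      rw [eq_maximalIdeal hm₁] at e₁
      rw [eq_maximalIdeal hm₂] at e₂
      let f : (M ⧸ N) →ₗ[A] (A ⧸ Ideal.span {b}) :=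
        T.subtype ∘ₗ (e₂.trans e₁.symm).toLinearMap
      have hf : Function.Injective f :=
        T.injective_subtype.comp (e₂.trans e₁.symm).injective
      let S' : ShortComplex (ModuleCat.{u} A) :=
        ModuleCat.shortComplexOfCompEqZero f (LinearMap.range f).mkQ (by
          ext x
          simp)
      have hS' : S'.ShortExact := by
        apply ModuleCat.shortComplex_shortExact
        · exact LinearMap.exact_map_mkQ_range f
        · exact hf
        · exact Submodule.mkQ_surjective _
      obtain ⟨e'', he''⟩ := Ext.contravariant_sequence_exact₁ hS' _ e' (add_comm 1 i)
        (ih' _ (hfin.of_surjective (Submodule.mkQ_surjective (LinearMap.range f))) _)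
      have h0 : e'' = 0 := e''.eq_zero_of_hasProjectiveDimensionLT 2 hi
      rw [← he'', h0, Ext.comp_zero]

open IsLocalRing in
/-- If `0 → C → Q → E → 0` is exact, `C` has finite injective dimension, and a nonzerodivisor `b`
as above acts bijectively on `Q`, then the homomorphisms from the maximal ideal to `E` extend. -/
theorem exists_extend_maximalIdeal {b : A} (hb : b ∈ A⁰)
    (hbm : b ∈ maximalIdeal A) (hfin : IsFiniteLength A (A ⧸ Ideal.span {b}))
    {C Q E : Type u} [AddCommGroup C] [Module A C] [AddCommGroup Q] [Module A Q]
    [AddCommGroup E] [Module A E] (f : C →ₗ[A] Q) (g : Q →ₗ[A] E) (hf : Function.Injective f)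
    (hfg : Function.Exact f g) (hg : Function.Surjective g)
    (hQ : Function.Bijective fun y : Q => b • y)
    (hC : ∃ n, HasInjectiveDimensionLE (ModuleCat.of A C) n)
    (φ : maximalIdeal A →ₗ[A] E) : ∃ z : E, ∀ x, φ x = (x : A) • z := by
  obtain ⟨n, hn⟩ := hC
  let S : ShortComplex (ModuleCat.{u} A) :=
    ModuleCat.shortComplexOfCompEqZero f g hfg.linearMap_comp_eq_zero
  have hS : S.ShortExact := ModuleCat.shortComplex_shortExact _ hfg hf hg
  have hκ : IsFiniteLength A (A ⧸ maximalIdeal A) := by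
    have : IsSimpleModule A (A ⧸ maximalIdeal A) :=
      isSimpleModule_iff_quot_maximal.2 ⟨_, inferInstance, ⟨LinearEquiv.refl _ _⟩⟩
    exact isFiniteLength_iff_isNoetherian_isArtinian.2 ⟨inferInstance, inferInstance⟩
  let X := ModuleCat.of A (A ⧸ maximalIdeal A)
  have hX : ∀ x : X, b • x = 0 := by
    intro x
    obtain ⟨y, rfl⟩ := Submodule.mkQ_surjective _ x
    rw [← map_smul, Submodule.mkQ_apply, Submodule.Quotient.mk_eq_zero]
    exact Ideal.mul_mem_right _ _ hbm
  -- `Ext¹(k, E)` lies between `Ext¹(k, Q) = 0` and `Ext²(k, C) = 0`. Its vanishing is the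
  -- obstruction to extending `φ` from the maximal ideal to `A`.
  have hE : ∀ e : Ext.{u} X (ModuleCat.of A E) 1, e = 0 := by
    intro e
    obtain ⟨e', he'⟩ := Ext.covariant_sequence_exact₃ X hS e rfl
      (ext_eq_zero_of_hasInjectiveDimensionLT hb hbm hfin (ModuleCat.of A C) (n + 1) 2 le_rfl _ hκ
        _)
    rw [← he', ext_eq_zero_of_smul b (Y := ModuleCat.of A Q) hX hQ e', Ext.zero_comp]
  let S' : ShortComplex (ModuleCat.{u} A) :=
    ModuleCat.shortComplexOfCompEqZero (maximalIdeal A).subtype (maximalIdeal A).mkQ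
      (LinearMap.exact_subtype_mkQ _).linearMap_comp_eq_zero
  have hS' : S'.ShortExact := by
    apply ModuleCat.shortComplex_shortExact
    · exact LinearMap.exact_subtype_mkQ (maximalIdeal A)
    · exact (maximalIdeal A).injective_subtype
    · exact (maximalIdeal A).mkQ_surjective
  obtain ⟨y, hy⟩ := Ext.contravariant_sequence_exact₁ hS' _ (Ext.mk₀ (ModuleCat.ofHom φ))
    (add_zero 1) (hE _)
  obtain ⟨y, rfl⟩ := Ext.mk₀_bijective _ _ |>.2 y
  rw [Ext.mk₀_comp_mk₀] at hy
  have h := (Ext.mk₀_bijective _ _).1 hy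
  refine ⟨y.hom (1 : A), fun x => ?_⟩
  have h' := congrArg (fun t => t.hom x) h
  change y.hom (x : A) = φ x at h'
  rw [← h', ← map_smul, smul_eq_mul, mul_one]

end Ext

/-! ### A Baer-type criterion for injectivity in dimension one -/

section Injective

open IsLocalRing

variable {A : Type u} [CommRing A]

/-- In a one-dimensional Noetherian ring, the quotients by nonzerodivisors have finite length. -/
theorem isFiniteLength_quotient_span [IsNoetherianRing A] (hdim : ringKrullDim A = 1) {b : A}
    (hb : b ∈ A⁰) : IsFiniteLength A (A ⧸ Ideal.span {b}) := by
  have : Ring.KrullDimLE 1 A := (Order.krullDimLE_iff 1 _).2 hdim.le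
  exact isFiniteLength_quotient_span_singleton A hb

variable [IsLocalRing A]

/-- A nonzero module of finite length contains a simple submodule, here a copy of the residue field;
`x` lifts its generator. -/
theorem exists_notMem_of_isFiniteLength {J : Ideal A} (hJ : J ≠ ⊤) (hf : IsFiniteLength A (A ⧸ J)) :
    ∃ x, x ∉ J ∧ ∀ r ∈ maximalIdeal A, r * x ∈ J := by
  obtain ⟨hnoe, hart⟩ := isFiniteLength_iff_isNoetherian_isArtinian.1 hf
  have : Nontrivial (A ⧸ J) := Submodule.Quotient.nontrivial_iff.2 hJ
  obtain ⟨T, hT, -⟩ := (IsAtomic.eq_bot_or_exists_atom_le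
    (⊤ : Submodule A (A ⧸ J))).resolve_left top_ne_bot
  have hT' : IsSimpleModule A T := isSimpleModule_iff_isAtom.2 hT
  obtain ⟨m₁, hm₁, ⟨e₁⟩⟩ := isSimpleModule_iff_quot_maximal.1 hT'
  rw [eq_maximalIdeal hm₁] at e₁
  obtain ⟨x, hx⟩ := Submodule.mkQ_surjective _ (e₁.symm (Submodule.Quotient.mk 1) : A ⧸ J)
  refine ⟨x, fun hxJ => ?_, fun r hr => ?_⟩
  · rw [← Submodule.Quotient.mk_eq_zero, ← Submodule.mkQ_apply, hx, Submodule.coe_eq_zero,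
      LinearEquiv.map_eq_zero_iff, Submodule.Quotient.mk_eq_zero] at hxJ
    exact (maximalIdeal.isMaximal A).ne_top ((Ideal.eq_top_iff_one _).2 hxJ)
  · rw [← Submodule.Quotient.mk_eq_zero, ← smul_eq_mul, ← Submodule.mkQ_apply, map_smul, hx,
      ← Submodule.coe_smul, ← map_smul, ← Submodule.Quotient.mk_smul, smul_eq_mul, mul_one,
      (Submodule.Quotient.mk_eq_zero _).2 hr, map_zero, Submodule.coe_zero]

variable [IsNoetherianRing A]

variable {E : Type u} [AddCommGroup E] [Module A E]

/-- Noetherian induction on the domain `J`. For a socle element `x` of `A/J` the map `r ↦ f (r x)`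
is defined on the maximal ideal, and the element `z` extending it is a consistent value at `x`, so
`f` extends to `J + Ax`. -/
theorem exists_extend_of_isFiniteLength
    (hE : ∀ φ : maximalIdeal A →ₗ[A] E, ∃ z : E, ∀ x, φ x = (x : A) • z)
    (f : A →ₗ.[A] E) (hf : IsFiniteLength A (A ⧸ f.domain)) :
    ∃ z : E, ∀ x : f.domain, f x = (x : A) • z := by
  obtain ⟨J, hJ⟩ : ∃ J, J = f.domain := ⟨_, rfl⟩
  induction J using WellFoundedGT.induction generalizing f with
  | ind J ih =>
    by_cases htop : f.domain = ⊤
    · refine ⟨f ⟨1, htop ▸ Submodule.mem_top⟩, fun x => ?_⟩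
      rw [← LinearPMap.map_smul]
      congr 1
      ext
      simp
    obtain ⟨x, hxJ, hxm⟩ := exists_notMem_of_isFiniteLength htop hf
    have hmx : ∀ r, r * x ∈ f.domain → r ∈ maximalIdeal A := by
      intro r hr
      by_contra h
      rw [mem_maximalIdeal, mem_nonunits_iff, not_not] at h
      exact hxJ ((f.domain.smul_mem_iff_of_isUnit h).1 hr)
    let g : maximalIdeal A →ₗ[A] E := f.toFun ∘ₗ
      ((LinearMap.toSpanSingleton A A x ∘ₗ (maximalIdeal A).subtype).codRestrict f.domain
        fun r => hxm r r.2)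
    obtain ⟨z, hz⟩ := hE g
    have hz' : ∀ r (h : r * x ∈ f.domain), f ⟨r * x, h⟩ = r • z := fun r h => hz ⟨r, hmx r h⟩
    let g' : A →ₗ.[A] E := LinearPMap.mkSpanSingleton' x z (by
      intro c hc
      have hc' : c * x ∈ f.domain := by
        rw [← smul_eq_mul, hc]
        exact zero_mem _
      rw [RingHom.id_apply, ← hz' c hc', ← f.map_zero]
      congr 1
      ext
      exact hc)
    have hcompat : ∀ (y : f.domain) (y' : g'.domain), (y : A) = y' → f y = g' y' := by
      rintro ⟨y, hy⟩ ⟨y', hy'⟩ rfl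
      obtain ⟨c, rfl⟩ := Submodule.mem_span_singleton.1 hy'
      rw [LinearPMap.mkSpanSingleton'_apply]
      exact hz' c hy
    have hle := f.left_le_sup g' hcompat
    obtain ⟨w, hw⟩ := ih (f.sup g' hcompat).domain (by
        rw [hJ, LinearPMap.domain_sup]
        refine lt_of_le_of_ne le_sup_left fun h => hxJ ?_
        rw [h]
        exact Submodule.mem_sup_right (Submodule.mem_span_singleton_self x))
      _ (hf.of_surjective (f := Submodule.factor hle.1) (Submodule.factor_surjective _)) rfl
    exact ⟨w, fun y => (hle.2 (y := ⟨y, hle.1 y.2⟩) rfl).trans (hw _)⟩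

/-- A criterion for injectivity over a one-dimensional Cohen-Macaulay local ring. -/
theorem injective_of_exists_extend_maximalIdeal
    (hfin : ∀ c ∈ A⁰, IsFiniteLength A (A ⧸ Ideal.span {c}))
    (htors : ∀ z : E, ∃ c ∈ A⁰, c • z = 0)
    (hE : ∀ φ : maximalIdeal A →ₗ[A] E, ∃ z : E, ∀ x, φ x = (x : A) • z) :
    Module.Injective A E := by
  apply Module.Baer.injective
  intro J φ
  obtain ⟨c, hc, hcφ⟩ : ∃ c ∈ A⁰, ∀ x, c • φ x = 0 := by
    have hfg : (LinearMap.range φ).FG := Module.Finite.iff_fg.1 inferInstance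
    have key : ∀ N : Submodule A E, N.FG → ∃ c ∈ A⁰, ∀ x ∈ N, c • x = 0 := by
      intro N hN
      induction N, hN using Submodule.fg_induction with
      | singleton x =>
        obtain ⟨c, hc, h⟩ := htors x
        refine ⟨c, hc, fun y hy => ?_⟩
        obtain ⟨r, rfl⟩ := Submodule.mem_span_singleton.1 hy
        rw [smul_comm, h, smul_zero]
      | sup N₁ N₂ _ _ h₁ h₂ =>
        obtain ⟨c₁, hc₁, h₁⟩ := h₁
        obtain ⟨c₂, hc₂, h₂⟩ := h₂
        refine ⟨c₁ * c₂, mul_mem hc₁ hc₂, fun y hy => ?_⟩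
        obtain ⟨y₁, hy₁, y₂, hy₂, rfl⟩ := Submodule.mem_sup.1 hy
        rw [smul_add, mul_comm, mul_smul, h₁ _ hy₁, smul_zero, zero_add, mul_comm, mul_smul,
          h₂ _ hy₂, smul_zero]
    obtain ⟨c, hc, h⟩ := key _ hfg
    exact ⟨c, hc, fun x => h _ (LinearMap.mem_range_self φ x)⟩
  -- Artin–Rees gives `(c ^ (k + 1)) ∩ J ⊆ cJ`, where `φ` vanishes. So `φ` glues with the zero map
  -- on `(c ^ (k + 1))`, and the glued domain has finite colength.
  obtain ⟨k, hk⟩ := Ideal.exists_pow_inf_eq_pow_smul (Ideal.span {c}) J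
  have hk1 := hk (k + 1) (Nat.le_succ k)
  rw [Nat.add_sub_cancel_left, pow_one] at hk1
  let f : A →ₗ.[A] E := ⟨J, φ⟩
  let g : A →ₗ.[A] E := ⟨Ideal.span {c ^ (k + 1)}, 0⟩
  have hcompat : ∀ (y : f.domain) (y' : g.domain), (y : A) = y' → f y = g y' := by
    rintro ⟨y, hy⟩ ⟨y', hy'⟩ rfl
    have h1 : y ∈ Ideal.span {c} ^ (k + 1) • (⊤ : Ideal A) ⊓ J := by
      refine ⟨?_, hy⟩
      rw [Ideal.span_singleton_pow, smul_eq_mul, Ideal.mul_top]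
      exact hy'
    rw [hk1, Submodule.ideal_span_singleton_smul, Submodule.mem_smul_pointwise_iff_exists] at h1
    obtain ⟨t, ht, rfl⟩ := h1
    have : f ⟨c • t, hy⟩ = c • φ ⟨t, ht.2⟩ := by
      rw [← map_smul]
      rfl
    rw [this, hcφ]
    rfl
  have hle := f.left_le_sup g hcompat
  have hle' := f.right_le_sup g hcompat
  obtain ⟨z, hz⟩ := exists_extend_of_isFiniteLength hE (f.sup g hcompat)
    ((hfin _ (pow_mem hc (k + 1))).of_surjective (f := Submodule.factor hle'.1)
      (Submodule.factor_surjective _))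
  refine ⟨LinearMap.toSpanSingleton A E z, fun x hx => ?_⟩
  exact ((hle.2 (x := ⟨x, hx⟩) (y := ⟨x, hle.1 hx⟩) rfl).trans (hz _)).symm

end Injective

/-! ### Injectivity and homomorphisms in the total ring of fractions -/

section Fractions

open IsLocalRing

variable {R : Type u} [CommRing R] {F : Type u} [CommRing F] [Algebra R F] [IsFractionRing R F]

variable (R) in
theorem exists_smul_mem_one (x : F) : ∃ c ∈ R⁰, c • x ∈ (1 : Submodule R F) := by
  obtain ⟨⟨r, c⟩, h⟩ := IsLocalization.surj R⁰ x
  refine ⟨c, c.2, ?_⟩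
  rw [Submodule.mem_one, Algebra.smul_def, mul_comm]
  exact ⟨r, h.symm⟩

theorem exists_smul_le_one (N : Submodule R F) (hN : N.FG) :
    ∃ c ∈ R⁰, ∀ x ∈ N, c • x ∈ (1 : Submodule R F) := by
  induction N, hN using Submodule.fg_induction with
  | singleton x =>
    obtain ⟨c, hc, h⟩ := exists_smul_mem_one R x
    refine ⟨c, hc, fun y hy => ?_⟩
    obtain ⟨r, rfl⟩ := Submodule.mem_span_singleton.1 hy
    rw [smul_comm]
    exact Submodule.smul_mem _ _ h
  | sup N₁ N₂ _ _ h₁ h₂ =>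
    obtain ⟨c₁, hc₁, h₁⟩ := h₁
    obtain ⟨c₂, hc₂, h₂⟩ := h₂
    refine ⟨c₁ * c₂, mul_mem hc₁ hc₂, fun y hy => ?_⟩
    obtain ⟨y₁, hy₁, y₂, hy₂, rfl⟩ := Submodule.mem_sup.1 hy
    rw [smul_add]
    refine add_mem ?_ ?_
    · rw [mul_comm, mul_smul]
      exact Submodule.smul_mem _ _ (h₁ _ hy₁)
    · rw [mul_smul]
      exact Submodule.smul_mem _ _ (h₂ _ hy₂)

variable (F) in
theorem bijective_smul_of_mem_nonZeroDivisors {b : R} (hb : b ∈ R⁰) :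
    Function.Bijective fun y : F => b • y := by
  have h := IsLocalization.map_units F (⟨b, hb⟩ : R⁰)
  have h' : (fun y : F => b • y) = fun y : F => algebraMap R F b * y := by
    ext
    rw [Algebra.smul_def]
  rw [h']
  exact h.unit.mulLeft.bijective

/-- Homomorphisms from a finitely generated fractional ideal to an injective quotient of the total
ring of fractions are given by multiplication. -/
theorem exists_eq_mul {E : Type u} [AddCommGroup E] [Module R E] [Module.Injective R E]
    (π : F →ₗ[R] E) (hπ : Function.Surjective π) (N : Submodule R F) (hN : N.FG)
    (φ : N →ₗ[R] E) : ∃ f : F, ∀ y : N, φ y = π (f * y) := by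
  obtain ⟨ψ, hψ⟩ := Module.Injective.extension_property R E N F N.subtype N.injective_subtype φ
  obtain ⟨c, hc, hcN⟩ := exists_smul_le_one N hN
  obtain ⟨d, hd⟩ := (bijective_smul_of_mem_nonZeroDivisors F hc).2 1
  obtain ⟨g, hg⟩ := hπ (ψ d)
  -- Here `d = 1/c` and `c y` lies in `R` for `y` in `N`, so `ψ y = (c y) ψ d = π ((c y) g)`.
  refine ⟨c • g, fun y => ?_⟩
  obtain ⟨r, hr⟩ := Submodule.mem_one.1 (hcN y y.2)
  have hy : (y : F) = r • d := by
    have : (y : F) = (c • d) * y := by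
      rw [show c • d = 1 from hd, one_mul]
    rw [this, smul_mul_assoc, mul_comm d, ← smul_mul_assoc, ← hr, Algebra.smul_def]
  rw [← hψ, LinearMap.comp_apply, Submodule.subtype_apply, hy, map_smul, ← hg, ← map_smul]
  congr 1
  rw [mul_smul_comm, smul_mul_assoc, mul_comm g, ← smul_mul_assoc, show c • d = 1 from hd, one_mul]

variable [IsLocalRing R] [IsNoetherianRing R]

/-- A form of Krull's intersection theorem. -/
theorem mem_of_forall_exists_sub_mem {a : R} (ham : a ∈ maximalIdeal R) {M : Type*}
    [AddCommGroup M] [Module R M] [Module.Finite R M] (N : Submodule R M) (x : M)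
    (h : ∀ n : ℕ, ∃ y, x - a ^ n • y ∈ N) : x ∈ N := by
  have hinf : N.mkQ x ∈ (⨅ i : ℕ, Ideal.span {a} ^ i • ⊤ : Submodule R (M ⧸ N)) := by
    rw [Submodule.mem_iInf]
    intro n
    obtain ⟨y, hy⟩ := h n
    have : N.mkQ x = a ^ n • N.mkQ y := by
      rw [← map_smul, ← sub_eq_zero, ← map_sub, Submodule.mkQ_apply, Submodule.Quotient.mk_eq_zero]
      exact hy
    rw [this, Ideal.span_singleton_pow]
    exact Submodule.smul_mem_smul (Ideal.mem_span_singleton_self _) Submodule.mem_top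
  rw [Ideal.iInf_pow_smul_eq_bot_of_isLocalRing _ (by
    rw [Ne, Ideal.span_singleton_eq_top]
    exact ham), Submodule.mem_bot, Submodule.mkQ_apply, Submodule.Quotient.mk_eq_zero] at hinf
  exact hinf

/-- The total ring of fractions is injective if there is a finitely generated fractional ideal `K`
containing the unit element such that `F / K` is injective. -/
theorem injective_fractionRing {a : R} (ha : a ∈ R⁰) (ham : a ∈ maximalIdeal R)
    (K : Submodule R F) (h1 : (1 : F) ∈ K) (hK : K.FG) [Module.Injective R (F ⧸ K)] :
    Module.Injective R F := by
  apply Module.Baer.injective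
  intro J φ
  have hinv : ∀ c ∈ R⁰, ∃ d : F, ∀ y : F, c • (d * y) = y := by
    intro c hc
    obtain ⟨d, hd⟩ := (bijective_smul_of_mem_nonZeroDivisors F hc).2 1
    exact ⟨d, fun y => by rw [← smul_mul_assoc, show c • d = 1 from hd, one_mul]⟩
  -- The image of `φ` is finitely generated, so a common denominator moves it into `K`; then `Hom(J,
  -- K)` is finitely generated and Krull's theorem applies to its submodule of multiplications.
  suffices key : ∀ ψ : J →ₗ[R] K, ∃ f : F, ∀ x, (ψ x : F) = (x : R) • f by
    obtain ⟨c, hc, h⟩ := exists_smul_le_one (LinearMap.range φ) (Module.Finite.iff_fg.1 inferInstance)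
    have hle : (1 : Submodule R F) ≤ K := by
      rw [Submodule.one_eq_span, Submodule.span_singleton_le_iff_mem]
      exact h1
    obtain ⟨f, hf⟩ := key ((c • φ).codRestrict K fun x => hle (h _ (LinearMap.mem_range_self φ x)))
    obtain ⟨d, hd⟩ := hinv c hc
    refine ⟨LinearMap.toSpanSingleton R F (d * f), fun x hx => ?_⟩
    apply (bijective_smul_of_mem_nonZeroDivisors F hc).1
    have := hf ⟨x, hx⟩
    simp only [LinearMap.toSpanSingleton_apply]
    rw [smul_comm, hd, ← this]
    rfl
  intro ψ
  have hKfin : Module.Finite R K := Module.Finite.iff_fg.2 hK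
  have hHfin : Module.Finite R (J →ₗ[R] K) := Module.IsNoetherian.finite R _
  let N : Submodule R (J →ₗ[R] K) :=
    { carrier := {θ | ∃ f : F, ∀ x, (θ x : F) = (x : R) • f}
      zero_mem' := ⟨0, by simp⟩
      add_mem' := by
        rintro θ θ' ⟨f, hf⟩ ⟨f', hf'⟩
        exact ⟨f + f', fun x => by simp [hf, hf']⟩
      smul_mem' := by
        rintro r θ ⟨f, hf⟩
        exact ⟨r • f, fun x => by simp [hf, smul_comm r]⟩ }
  change ψ ∈ N
  -- Modulo `K`, the map `ψ / a ^ n` is `x ↦ x g` because `F/K` is injective. The difference `θ`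
  -- takes values in `K`, and `ψ - a ^ n θ` is multiplication by `a ^ n g`.
  have hcl : ∀ n : ℕ, ∃ θ, ψ - a ^ n • θ ∈ N := by
    intro n
    obtain ⟨d, hd⟩ := hinv _ (pow_mem ha n)
    obtain ⟨χ, hχ⟩ := (Module.Baer.of_injective (inferInstance : Module.Injective R (F ⧸ K))) J
      (K.mkQ ∘ₗ LinearMap.mulLeft R d ∘ₗ K.subtype ∘ₗ ψ)
    obtain ⟨g, hg⟩ := K.mkQ_surjective (χ 1)
    have hmem : ∀ x : J, d * ψ x - (x : R) • g ∈ K := by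
      intro x
      have := hχ x x.2
      rw [← Submodule.Quotient.mk_eq_zero, Submodule.Quotient.mk_sub, sub_eq_zero,
        Submodule.Quotient.mk_smul]
      change _ = (x : R) • K.mkQ g
      rw [hg, ← map_smul, smul_eq_mul, mul_one]
      exact this.symm
    let θ : J →ₗ[R] K := (LinearMap.mulLeft R d ∘ₗ K.subtype ∘ₗ ψ -
      LinearMap.toSpanSingleton R F g ∘ₗ J.subtype).codRestrict K hmem
    refine ⟨θ, a ^ n • g, fun x => ?_⟩
    have h1 : (θ x : F) = d * ψ x - (x : R) • g := rfl
    rw [LinearMap.sub_apply, LinearMap.smul_apply, Submodule.coe_sub, Submodule.coe_smul, h1,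
      smul_sub, hd, sub_sub_cancel, smul_comm]
  exact mem_of_forall_exists_sub_mem ham N ψ hcl

end Fractions

/-! ### Modules with simple socle -/

section Socle

open IsLocalRing

variable (A : Type u) [CommRing A] [IsLocalRing A] (E : Type u) [AddCommGroup E] [Module A E]

/-- The socle of `E` is a simple module. -/
def HasSimpleSocle : Prop :=
  ∃ w : E, w ≠ 0 ∧ (∀ r ∈ maximalIdeal A, r • w = 0) ∧
    ∀ y : E, (∀ r ∈ maximalIdeal A, r • y = 0) → ∃ r : A, y = r • w

/-- Evaluation at the class of `1` identifies `Hom(A/𝔪, E)` with the socle of `E`. -/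
theorem length_hom_eq_one_iff :
    Module.length A ((A ⧸ maximalIdeal A) →ₗ[A] E) = 1 ↔ HasSimpleSocle A E := by
  have hkill : ∀ (φ : (A ⧸ maximalIdeal A) →ₗ[A] E), ∀ r ∈ maximalIdeal A,
      r • φ (Submodule.Quotient.mk 1) = 0 := by
    intro φ r hr
    rw [← map_smul, ← Submodule.Quotient.mk_smul, smul_eq_mul, mul_one,
      (Submodule.Quotient.mk_eq_zero _).2 hr, map_zero]
  have hhom : ∀ y : E, (∀ r ∈ maximalIdeal A, r • y = 0) →
      ∃ φ : (A ⧸ maximalIdeal A) →ₗ[A] E, φ (Submodule.Quotient.mk 1) = y := by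
    intro y hy
    exact ⟨(maximalIdeal A).liftQ (LinearMap.toSpanSingleton A E y) hy, one_smul A y⟩
  have hext : ∀ φ ψ : (A ⧸ maximalIdeal A) →ₗ[A] E,
      φ (Submodule.Quotient.mk 1) = ψ (Submodule.Quotient.mk 1) → φ = ψ := by
    intro φ ψ h
    apply Submodule.linearMap_qext
    ext
    exact h
  rw [Module.length_eq_one_iff, isSimpleModule_iff_toSpanSingleton_surjective]
  constructor
  · rintro ⟨hn, hs⟩
    obtain ⟨φ, hφ⟩ := exists_ne (0 : (A ⧸ maximalIdeal A) →ₗ[A] E)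
    refine ⟨φ (Submodule.Quotient.mk 1), fun h => hφ (hext _ _ h), hkill φ, fun y hy => ?_⟩
    obtain ⟨ψ, rfl⟩ := hhom y hy
    obtain ⟨r, rfl⟩ := hs φ hφ ψ
    exact ⟨r, rfl⟩
  · rintro ⟨w, hw0, hw, hy⟩
    obtain ⟨φ, hφ⟩ := hhom w hw
    refine ⟨⟨φ, 0, fun h => hw0 ?_⟩, fun ψ hψ χ => ?_⟩
    · rw [← hφ, h, LinearMap.zero_apply]
    · obtain ⟨r, hr⟩ := hy _ (hkill ψ)
      obtain ⟨s, hs⟩ := hy _ (hkill χ)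
      have hu : IsUnit r := by
        by_contra h
        exact hψ (hext _ _ (by rw [hr, hw r h, LinearMap.zero_apply]))
      obtain ⟨t, ht⟩ := hu.exists_left_inv
      refine ⟨s * t, hext _ _ ?_⟩
      rw [LinearMap.toSpanSingleton_apply, LinearMap.smul_apply, hr, hs, smul_smul, mul_assoc, ht,
        mul_one]

variable {A E}

/-- The half of Matlis duality that does not need `E` injective: `Hom(-, E)` is left exact and takes
the simple module to one of length one. -/
theorem length_hom_le (hE : HasSimpleSocle A E) (V : Type u) [AddCommGroup V] [Module A V]
    (hV : IsFiniteLength A V) : Module.length A (V →ₗ[A] E) ≤ Module.length A V := by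
  induction hV with
  | of_subsingleton => rw [Module.length_eq_zero]; exact zero_le
  | @of_simple_quotient M _ _ N hs hN ih =>
    have h1 := Module.length_eq_add_of_exact N.subtype N.mkQ N.injective_subtype N.mkQ_surjective
      (LinearMap.exact_subtype_mkQ N)
    have h2 := Module.length_eq_add_of_exact (LinearMap.lcomp A E N.mkQ)
      (LinearMap.lcomp A E N.subtype).rangeRestrict
      (fun φ ψ h => Submodule.linearMap_qext _ h) (LinearMap.surjective_rangeRestrict _) (by
        intro φ
        constructor
        · intro h
          have h' : φ ∘ₗ N.subtype = 0 := congrArg Subtype.val h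
          refine ⟨N.liftQ φ fun x hx => LinearMap.congr_fun h' ⟨x, hx⟩, ?_⟩
          exact N.liftQ_mkQ φ fun x hx => LinearMap.congr_fun h' ⟨x, hx⟩
        · rintro ⟨ψ, rfl⟩
          ext x
          change ψ (N.mkQ x) = 0
          rw [Submodule.mkQ_apply, (Submodule.Quotient.mk_eq_zero _).2 x.2, map_zero])
    obtain ⟨m₁, hm₁, ⟨e₁⟩⟩ := isSimpleModule_iff_quot_maximal.1 hs
    rw [eq_maximalIdeal hm₁] at e₁
    have h3 : Module.length A ((M ⧸ N) →ₗ[A] E) = 1 := by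
      rw [← (length_hom_eq_one_iff A E).2 hE]
      exact (LinearEquiv.congrLeft E A e₁).length_eq
    rw [h2, h3, h1, Module.length_eq_one A (M ⧸ N), add_comm]
    exact add_le_add_left ((Module.length_le_of_injective _
      (Submodule.injective_subtype _)).trans ih) _

/-- The class of `s` generates a nonzero quotient of `A/(c)`, which has finite length and hence a
nonzero socle. -/
theorem exists_mem_socle {M : Type*} [AddCommGroup M] [Module A M] (X : Submodule A M) {c : A}
    (hc : IsFiniteLength A (A ⧸ Ideal.span {c})) {s : M} (hs : s ∉ X) (hcs : c • s ∈ X) :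
    ∃ x : A, x • s ∉ X ∧ ∀ r ∈ maximalIdeal A, r • x • s ∈ X := by
  let J : Ideal A := X.comap (LinearMap.toSpanSingleton A M s)
  have hJ : ∀ r, r ∈ J ↔ r • s ∈ X := fun r => Iff.rfl
  have hJtop : J ≠ ⊤ := by
    rw [Ne, Ideal.eq_top_iff_one, hJ, one_smul]
    exact hs
  have hle : Ideal.span {c} ≤ J := by
    rw [Ideal.span_singleton_le_iff_mem]
    exact hcs
  obtain ⟨x, hx, hx'⟩ := exists_notMem_of_isFiniteLength hJtop
    (hc.of_surjective (f := Submodule.factor hle) (Submodule.factor_surjective _))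
  refine ⟨x, hx, fun r hr => ?_⟩
  rw [smul_smul]
  exact hx' r hr

end Socle

/-! ### Dualizing fractional ideals and biduality -/

section Dualizing

open IsLocalRing

variable {R : Type u} [CommRing R] {F : Type u} [CommRing F] [Algebra R F]

/-- A fractional ideal `K` with the properties of a canonical module. -/
structure IsDualizing [IsLocalRing R] (K : Submodule R F) : Prop where
  one_mem : (1 : F) ∈ K
  injective : Module.Injective R (F ⧸ K)
  injective_fractions : Module.Injective R F
  socle : HasSimpleSocle R (F ⧸ K)

variable [IsFractionRing R F] [IsLocalRing R] [IsNoetherianRing R] {K : Submodule R F}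

theorem IsDualizing.one_le (hK : IsDualizing K) : 1 ≤ K := by
  rw [Submodule.one_eq_span, Submodule.span_singleton_le_iff_mem]
  exact hK.one_mem

/-- The class of `s` is a nonzero element of the simple socle of `F/K`, so it generates that socle.
-/
theorem IsDualizing.exists_sub_smul_mem (hK : IsDualizing K) {s : F} (hs : s ∉ K)
    (hs' : ∀ y ∈ maximalIdeal R, y • s ∈ K) {x : F} (hx : ∀ y ∈ maximalIdeal R, y • x ∈ K) :
    ∃ r : R, x - r • s ∈ K := by
  obtain ⟨w, hw0, hw, hsoc⟩ := hK.socle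
  have hmk : ∀ t, (∀ y ∈ maximalIdeal R, y • t ∈ K) → ∃ r : R, K.mkQ t = r • w := by
    intro t ht
    apply hsoc
    intro y hy
    rw [← map_smul, Submodule.mkQ_apply, Submodule.Quotient.mk_eq_zero]
    exact ht y hy
  obtain ⟨r, hr⟩ := hmk s hs'
  obtain ⟨r', hr'⟩ := hmk x hx
  have hu : IsUnit r := by
    by_contra h
    rw [hw r h, Submodule.mkQ_apply, Submodule.Quotient.mk_eq_zero] at hr
    exact hs hr
  obtain ⟨t, ht⟩ := hu.exists_left_inv
  refine ⟨r' * t, ?_⟩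
  rw [← Submodule.Quotient.mk_eq_zero, ← Submodule.mkQ_apply, map_sub, map_smul, hr, hr',
    smul_smul, mul_assoc, ht, mul_one, sub_self]

/-- A fractional ideal isomorphic to a canonical module is dualizing. -/
theorem isDualizing_of_isCanonicalModule {a : R} (ha : a ∈ R⁰) (ham : a ∈ maximalIdeal R)
    (hdim : ringKrullDim R = 1) (C : Type u) [AddCommGroup C] [Module R C]
    (hC : IsCanonicalModule R C) (h1 : (1 : F) ∈ K) (e : C ≃ₗ[R] K) : IsDualizing K := by
  have hCfin := hC.maximal.finite
  have hfin : ∀ c ∈ R⁰, IsFiniteLength R (R ⧸ Ideal.span {c}) :=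
    fun c hc => isFiniteLength_quotient_span hdim hc
  let f : C →ₗ[R] F := K.subtype ∘ₗ e.toLinearMap
  have hf : Function.Injective f := K.injective_subtype.comp e.injective
  have hfg : Function.Exact f K.mkQ := by
    rw [LinearMap.exact_iff, Submodule.ker_mkQ, LinearMap.range_comp, LinearEquiv.range,
      Submodule.map_subtype_top]
  have hQ := bijective_smul_of_mem_nonZeroDivisors F ha
  have hle : (1 : Submodule R F) ≤ K := by
    rw [Submodule.one_eq_span, Submodule.span_singleton_le_iff_mem]
    exact h1
  have hKfg : K.FG := by
    have : Module.Finite R K := Module.Finite.equiv e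
    exact Module.Finite.iff_fg.1 this
  have hinj : Module.Injective R (F ⧸ K) := by
    refine injective_of_exists_extend_maximalIdeal hfin ?_
      (exists_extend_maximalIdeal ha ham (hfin a ha) f K.mkQ hf hfg K.mkQ_surjective hQ
        hC.injective_dim)
    intro z
    obtain ⟨y, rfl⟩ := K.mkQ_surjective z
    obtain ⟨c, hc, h⟩ := exists_smul_mem_one R y
    refine ⟨c, hc, ?_⟩
    rw [← map_smul, Submodule.mkQ_apply, Submodule.Quotient.mk_eq_zero]
    exact hle h
  refine ⟨h1, hinj, injective_fractionRing ha ham K h1 hKfg, ?_⟩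
  obtain ⟨d, hd, hlen⟩ := hC.type_one
  obtain rfl : d = 1 := by
    rw [hdim] at hd
    exact_mod_cast hd.symm
  rw [← length_hom_eq_one_iff, ← hlen]
  refine (length_ext_one a f K.mkQ hf hfg K.mkQ_surjective ?_ hQ).symm
  intro x
  obtain ⟨y, rfl⟩ := Submodule.mkQ_surjective _ x
  rw [← map_smul, Submodule.mkQ_apply, Submodule.Quotient.mk_eq_zero]
  exact Ideal.mul_mem_right _ _ ham

/-- Biduality of fractional ideals. -/
theorem IsDualizing.div_div (hK : IsDualizing K) (J : Submodule R F) (hJ : J.FG) :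
    K / (K / J) = J := by
  have hinj := hK.injective
  apply le_antisymm
  · intro x hx
    by_contra hxJ
    obtain ⟨w, hw0, hw, -⟩ := hK.socle
    -- The class of `x` is sent to a socle generator `w`; this is well defined because `c x ∈ J`
    -- forces `c ∈ 𝔪`. After extension to `F/J`, the map restricted to `J + Rx` is multiplication by
    -- some `f` with `f J ⊆ K` and `f x ∉ K`.
    let p : (F ⧸ J) →ₗ.[R] (F ⧸ K) := LinearPMap.mkSpanSingleton' (J.mkQ x) w (by
      intro c hc
      apply hw
      by_contra h
      rw [mem_maximalIdeal, mem_nonunits_iff, not_not] at h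
      rw [← map_smul, Submodule.mkQ_apply, Submodule.Quotient.mk_eq_zero,
        ] at hc
      exact hxJ ((J.smul_mem_iff_of_isUnit h).1 hc))
    obtain ⟨θ, hθ⟩ := Module.Injective.extension_property R (F ⧸ K) _ _ p.domain.subtype
      p.domain.injective_subtype p.toFun
    have hθx : θ (J.mkQ x) = w := by
      have := LinearMap.congr_fun hθ ⟨J.mkQ x, Submodule.mem_span_singleton_self _⟩
      exact this.trans (LinearPMap.mkSpanSingleton'_apply_self _ _ _ _)
    let J' := J ⊔ Submodule.span R {x}
    obtain ⟨f, hf⟩ := exists_eq_mul K.mkQ K.mkQ_surjective J' (hJ.sup (Submodule.fg_span_singleton x))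
      (θ ∘ₗ J.mkQ ∘ₗ J'.subtype)
    have hfJ : f ∈ K / J := by
      rw [Submodule.mem_div_iff_forall_mul_mem]
      intro y hy
      have := hf ⟨y, Submodule.mem_sup_left hy⟩
      rw [← Submodule.Quotient.mk_eq_zero, ← Submodule.mkQ_apply, ← this]
      change θ (J.mkQ y) = 0
      rw [Submodule.mkQ_apply, (Submodule.Quotient.mk_eq_zero _).2 hy, map_zero]
    have hfx := hf ⟨x, Submodule.mem_sup_right (Submodule.mem_span_singleton_self x)⟩
    have h0 := Submodule.mem_div_iff_forall_mul_mem.1 hx f hfJ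
    rw [mul_comm, ← Submodule.Quotient.mk_eq_zero, ← Submodule.mkQ_apply, ← hfx] at h0
    exact hw0 (hθx.symm.trans h0)
  · intro x hx
    rw [Submodule.mem_div_iff_forall_mul_mem]
    intro y hy
    rw [mul_comm]
    exact Submodule.mem_div_iff_forall_mul_mem.1 hy x hx

/-- Biduality for `J = R`, since `K : R = K`. -/
theorem IsDualizing.div_self (hK : IsDualizing K) : K / K = 1 := by
  have h := hK.div_div 1 (by rw [Submodule.one_eq_span]; exact Submodule.fg_span_singleton 1)
  have h1 : K / 1 = K := by
    apply le_antisymm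
    · intro x hx
      have := Submodule.mem_div_iff_forall_mul_mem.1 hx 1 (Submodule.mem_one.2 ⟨1, map_one _⟩)
      rwa [mul_one] at this
    · intro x hx
      rw [Submodule.mem_div_iff_forall_mul_mem]
      intro y hy
      obtain ⟨r, rfl⟩ := Submodule.mem_one.1 hy
      rw [mul_comm, ← Algebra.smul_def]
      exact K.smul_mem r hx
  rwa [h1] at h

end Dualizing

/-! ### Relative length of submodules -/

section RelLength

variable {R : Type u} [CommRing R] {M : Type u} [AddCommGroup M] [Module R M]

/-- The length of `Y / X`. -/
def relLength (X Y : Submodule R M) : ℕ∞ :=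
  Module.length R (Y ⧸ X.submoduleOf Y)

theorem relLength_add {X Y Z : Submodule R M} (hXY : X ≤ Y) (hYZ : Y ≤ Z) :
    relLength X Z = relLength X Y + relLength Y Z := by
  have h1 : X.submoduleOf Y ≤ (X.submoduleOf Z).comap (Submodule.inclusion hYZ) := fun _ h => h
  have h2 : X.submoduleOf Z ≤ Y.submoduleOf Z := fun _ h => hXY h
  refine Module.length_eq_add_of_exact (Submodule.mapQ _ _ (Submodule.inclusion hYZ) h1)
    (Submodule.factor h2) ?_ (Submodule.factor_surjective h2) ?_
  · rw [← LinearMap.ker_eq_bot, Submodule.ker_mapQ, eq_bot_iff, Submodule.map_le_iff_le_comap,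
      Submodule.comap_bot, Submodule.ker_mkQ]
    exact fun _ h => h
  · intro z
    obtain ⟨z, rfl⟩ := Submodule.mkQ_surjective _ z
    constructor
    · intro h
      have hz : z ∈ Y.submoduleOf Z := (Submodule.Quotient.mk_eq_zero _).1 h
      exact ⟨Submodule.Quotient.mk ⟨z, hz⟩, rfl⟩
    · rintro ⟨y, hy⟩
      obtain ⟨y, rfl⟩ := Submodule.mkQ_surjective _ y
      rw [← hy]
      exact (Submodule.Quotient.mk_eq_zero _).2 y.2

theorem relLength_eq_zero_iff {X Y : Submodule R M} : relLength X Y = 0 ↔ Y ≤ X := by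
  rw [relLength, Module.length_eq_zero_iff, Submodule.Quotient.subsingleton_iff,
    Submodule.submoduleOf_eq_top]

theorem relLength_eq_one [IsLocalRing R] {X Y : Submodule R M} {w : M} (hw : w ∈ Y) (hwX : w ∉ X)
    (hm : ∀ r ∈ IsLocalRing.maximalIdeal R, r • w ∈ X)
    (hY : ∀ y ∈ Y, ∃ r : R, y - r • w ∈ X) : relLength X Y = 1 := by
  let f : (R ⧸ IsLocalRing.maximalIdeal R) →ₗ[R] (Y ⧸ X.submoduleOf Y) :=
    (IsLocalRing.maximalIdeal R).liftQ
      ((X.submoduleOf Y).mkQ ∘ₗ LinearMap.toSpanSingleton R Y ⟨w, hw⟩) (by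
        intro r hr
        exact (Submodule.Quotient.mk_eq_zero _).2 (hm r hr))
  have hf : Function.Surjective f := by
    intro y
    obtain ⟨y, rfl⟩ := Submodule.mkQ_surjective _ y
    obtain ⟨r, hr⟩ := hY y y.2
    refine ⟨Submodule.Quotient.mk r, Eq.symm ?_⟩
    rw [← sub_eq_zero]
    exact (Submodule.Quotient.mk_eq_zero _).2 hr
  have : IsSimpleModule R (R ⧸ IsLocalRing.maximalIdeal R) :=
    isSimpleModule_iff_quot_maximal.2 ⟨_, inferInstance, ⟨LinearEquiv.refl _ _⟩⟩
  apply le_antisymm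
  · rw [← Module.length_eq_one R (R ⧸ IsLocalRing.maximalIdeal R)]
    exact Module.length_le_of_surjective f hf
  · rw [Order.one_le_iff_ne_zero, Ne, relLength_eq_zero_iff]
    exact fun h => hwX (h hw)

end RelLength

/-! ### The algebra `B` and the module `L` as colons -/

section Colon

open IsLocalRing

variable {R : Type u} [CommRing R] [IsLocalRing R] {F : Type u} [CommRing F] [Algebra R F]

/-- The hypotheses of the main theorem, in terms of `K` and `S = R[K]`. -/
structure TwoAGLData (K S : Submodule R F) (α a : R) : Prop where
  dualizing : IsDualizing K
  regular : a ∈ R⁰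
  mem : a ∈ maximalIdeal R
  isFiniteLength : ∀ c ∈ R⁰, IsFiniteLength R (R ⧸ Ideal.span {c})
  regular_alpha : α ∈ R⁰
  mem_alpha : α ∈ maximalIdeal R
  exists_mul_eq : ∀ x ∈ maximalIdeal R, ∀ y ∈ maximalIdeal R, ∃ z ∈ maximalIdeal R, x * y = α * z
  le : K ≤ S
  mul_le : S * S ≤ S
  fg : S.FG
  le_of_mul_le : ∀ T : Submodule R F, K ≤ T → T * T ≤ T → S ≤ T
  length_eq : relLength K S = 2

/-- The `B`-module `B K`. -/
def spanB (K : Submodule R F) : Submodule (algB (R := R) F) F :=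
  Submodule.span (algB (R := R) F) (K : Set F)

theorem le_spanB (K : Submodule R F) : K ≤ (spanB K).restrictScalars R :=
  fun _ h => Submodule.subset_span h

variable [IsFractionRing R F] [IsNoetherianRing R] {K S : Submodule R F} {α a : R}

namespace TwoAGLData

variable (D : TwoAGLData K S α a)
include D

theorem one_mem : (1 : F) ∈ K := D.dualizing.one_mem

theorem exists_inv : ∃ d : F, α • d = 1 :=
  (bijective_smul_of_mem_nonZeroDivisors F D.regular_alpha).2 1

/-- This is `B = α⁻¹𝔪`: if `α x ∈ 𝔪`, then `α x 𝔪 ⊆ 𝔪² = α𝔪`, and `α` cancels. -/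
theorem mem_algB_iff (x : F) :
    x ∈ algB (R := R) F ↔ ∃ z ∈ maximalIdeal R, α • x = algebraMap R F z := by
  constructor
  · intro hx
    obtain ⟨z, hz, h⟩ := hx α D.mem_alpha
    exact ⟨z, hz, by rw [Algebra.smul_def, mul_comm, h]⟩
  · rintro ⟨z, hz, h⟩ y hy
    obtain ⟨z', hz', h'⟩ := D.exists_mul_eq z hz y hy
    refine ⟨z', hz', (bijective_smul_of_mem_nonZeroDivisors F D.regular_alpha).1 ?_⟩
    change α • (x * algebraMap R F y) = α • algebraMap R F z'
    rw [← smul_mul_assoc, h, ← map_mul, h', map_mul, Algebra.smul_def]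

theorem fg_algB : (Subalgebra.toSubmodule (algB (R := R) F)).FG := by
  obtain ⟨d, hd⟩ := D.exists_inv
  have : Subalgebra.toSubmodule (algB (R := R) F) =
      Submodule.map (LinearMap.mulLeft R d)
        (Submodule.map (Algebra.linearMap R F) (maximalIdeal R)) := by
    ext x
    rw [Subalgebra.mem_toSubmodule, D.mem_algB_iff]
    simp only [Submodule.mem_map, exists_exists_and_eq_and, LinearMap.mulLeft_apply,
      Algebra.linearMap_apply]
    refine exists_congr fun z => and_congr_right fun _ => ?_
    constructor
    · intro h
      rw [← h, mul_smul_comm, ← smul_mul_assoc, hd, one_mul]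
    · rintro rfl
      rw [← smul_mul_assoc, hd, one_mul]
  rw [this]
  exact Submodule.FG.map _ (Submodule.FG.map _ (IsNoetherian.noetherian (maximalIdeal R)))

theorem finite_algB : Module.Finite R (algB (R := R) F) :=
  Module.Finite.iff_fg.2 D.fg_algB

/-- Nakayama's lemma for `S`. -/
theorem not_le_smul : ¬ S ≤ maximalIdeal R • S := by
  intro h
  have h0 := Submodule.eq_bot_of_le_smul_of_le_jacobson_bot _ S D.fg h
    (maximalIdeal_le_jacobson _)
  have h1 : (1 : F) ∈ S := D.le D.one_mem
  rw [h0, Submodule.mem_bot] at h1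
  have : Nontrivial F := (IsFractionRing.nontrivial_iff_nontrivial R F).1 inferInstance
  exact one_ne_zero h1

/-- Some multiple `x s` of an element of `S` outside `R` satisfies `𝔪 x s ⊆ R`. If `B = R`, then `x
s ∉ B`, so `y x s` is a unit of `R` for some `y ∈ 𝔪`; this gives `S ⊆ 𝔪 S`, contrary to Nakayama. -/
theorem exists_mem_algB_notMem : ∃ b ∈ algB (R := R) F, b ∉ (1 : Submodule R F) := by
  by_contra! hB
  have hS : ¬ S ≤ 1 := by
    intro h
    have : relLength K S = 0 := relLength_eq_zero_iff.2 (h.trans D.dualizing.one_le)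
    rw [D.length_eq] at this
    exact absurd this (by decide)
  obtain ⟨s, hs, hs1⟩ := SetLike.not_le_iff_exists.1 hS
  obtain ⟨c, hc, hcs⟩ := exists_smul_mem_one R s
  obtain ⟨x, hx1, hx⟩ := exists_mem_socle 1 (D.isFiniteLength c hc) hs1 hcs
  have hxS : x • s ∈ S := S.smul_mem x hs
  obtain ⟨y, hy, u, hu, huy⟩ : ∃ y ∈ maximalIdeal R, ∃ u, IsUnit u ∧
      algebraMap R F u = y • x • s := by
    by_contra! hcon
    refine hx1 (hB _ fun y hy => ?_)
    obtain ⟨u, hu⟩ := Submodule.mem_one.1 (hx y hy)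
    refine ⟨u, ?_, ?_⟩
    · by_contra h
      exact hcon y hy u (not_not.1 h) hu
    · rw [hu, mul_comm, Algebra.smul_def y]
  obtain ⟨v, hv⟩ := hu.exists_left_inv
  apply D.not_le_smul
  intro t ht
  have h1 : y • (v • x • s * t) = t := by
    rw [← smul_mul_assoc, smul_comm, ← huy, Algebra.smul_def, ← map_mul, hv, map_one, one_mul]
  rw [← h1]
  exact Submodule.smul_mem_smul hy (D.mul_le (Submodule.mul_mem_mul (S.smul_mem _ hxS) ht))

/-- Otherwise `B ⊆ K : K = R`. -/
theorem not_spanB_le : ¬ (spanB K).restrictScalars R ≤ K := by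
  intro h
  obtain ⟨b, hb, hb1⟩ := D.exists_mem_algB_notMem
  apply hb1
  rw [← D.dualizing.div_self, Submodule.mem_div_iff_forall_mul_mem]
  intro y hy
  exact h ((spanB K).smul_mem (⟨b, hb⟩ : algB (R := R) F) (Submodule.subset_span hy))

/-- This is `L = K : 𝔪`. One inclusion is `𝔪B ⊆ 𝔪`; the other holds because `(K : 𝔪)/K` is the
simple socle of `F/K` and `L/K` is a nonzero part of it. -/
theorem mem_spanB_iff (x : F) : x ∈ spanB K ↔ ∀ y ∈ maximalIdeal R, y • x ∈ K := by
  have hle : ∀ x ∈ spanB K, ∀ y ∈ maximalIdeal R, y • x ∈ K := by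
    intro x hx
    induction hx using Submodule.span_induction with
    | mem x hx => exact fun y _ => K.smul_mem y hx
    | zero => simp
    | add x x' _ _ h h' =>
      intro y hy
      rw [smul_add]
      exact add_mem (h y hy) (h' y hy)
    | smul b x _ h =>
      intro y hy
      obtain ⟨z, hz, hyz⟩ := b.2 y hy
      rw [Algebra.smul_def, Subalgebra.smul_def, smul_eq_mul, ← mul_assoc, mul_comm _ (b : F), hyz,
        ← Algebra.smul_def]
      exact h z hz
  refine ⟨hle x, fun hx => ?_⟩
  obtain ⟨l, hl, hlK⟩ := SetLike.not_le_iff_exists.1 D.not_spanB_le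
  obtain ⟨r, h1⟩ := D.dualizing.exists_sub_smul_mem hlK (hle l hl) hx
  have h2 : x = (x - r • l) + r • l := by ring
  rw [h2]
  exact add_mem (Submodule.subset_span h1) (((spanB K).restrictScalars R).smul_mem _ hl)

/-- Since `𝔪 = αB`, the colon `K : 𝔪` is `α⁻¹(K : B)`. In this form `L` is the `K`-dual of `B` up to
a unit of `F`, which is how duality passes from `R` to `B`. -/
theorem mem_spanB_iff_forall_mul (x : F) :
    x ∈ spanB K ↔ ∀ b ∈ algB (R := R) F, α • (x * b) ∈ K := by
  constructor
  · intro hx b hb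
    obtain ⟨z, hz, h⟩ := (D.mem_algB_iff b).1 hb
    rw [← mul_smul_comm, h, mul_comm, ← Algebra.smul_def]
    exact (D.mem_spanB_iff x).1 hx z hz
  · intro h
    rw [D.mem_spanB_iff]
    intro y hy
    obtain ⟨d, hd⟩ := D.exists_inv
    have h1 : α • (d * algebraMap R F y) = algebraMap R F y := by
      rw [← smul_mul_assoc, hd, one_mul]
    have h2 := h _ ((D.mem_algB_iff _).2 ⟨y, hy, h1⟩)
    rwa [← mul_smul_comm, h1, mul_comm, ← Algebra.smul_def] at h2

/-- For `g ∈ K : B` the element `g/α` lies in `L`, so `x g/α ∈ L` and `x g ∈ K`. Hence `x ∈ K : (K :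
B) = B`. -/
theorem mem_algB_of_mul_mem (x : F) (hx : ∀ l ∈ spanB K, x * l ∈ spanB K) :
    x ∈ algB (R := R) F := by
  rw [← Subalgebra.mem_toSubmodule, ← D.dualizing.div_div _ D.fg_algB,
    Submodule.mem_div_iff_forall_mul_mem]
  intro g hg
  obtain ⟨d, hd⟩ := D.exists_inv
  have h1 : ∀ t : F, α • (d * t) = t := fun t => by rw [← smul_mul_assoc, hd, one_mul]
  have hl : d * g ∈ spanB K := by
    rw [D.mem_spanB_iff_forall_mul]
    intro b hb
    rw [mul_assoc, h1]
    exact Submodule.mem_div_iff_forall_mul_mem.1 hg b hb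
  have h2 := (D.mem_spanB_iff_forall_mul _).1 (hx _ hl) 1
    (algB (R := R) F).one_mem
  rwa [mul_one, ← mul_smul_comm, h1] at h2

/-- `S/K` is nonzero, so it meets the simple socle `L/K` of `F/K` and therefore contains it. -/
theorem spanB_le : (spanB K).restrictScalars R ≤ S := by
  have hS : ¬ S ≤ K := by
    intro h
    have := relLength_eq_zero_iff.2 h
    rw [D.length_eq] at this
    exact absurd this (by decide)
  obtain ⟨s, hs, hsK⟩ := SetLike.not_le_iff_exists.1 hS
  obtain ⟨c, hc, hcs⟩ := exists_smul_mem_one R s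
  obtain ⟨x, hxK, hx⟩ := exists_mem_socle K (D.isFiniteLength c hc) hsK (D.dualizing.one_le hcs)
  intro l hl
  obtain ⟨r, h1⟩ := D.dualizing.exists_sub_smul_mem hxK hx ((D.mem_spanB_iff l).1 hl)
  have h2 : l = (l - r • x • s) + r • x • s := by ring
  rw [h2]
  exact add_mem (D.le h1) (S.smul_mem _ (S.smul_mem _ hs))

end TwoAGLData

end Colon

/-! ### The quotient `L²/L`, its annihilator `M`, and injectivity over `B` -/

section Structure

open IsLocalRing

variable {R : Type u} [CommRing R] [IsLocalRing R] {F : Type u} [CommRing F] [Algebra R F]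
  [IsFractionRing R F] [IsNoetherianRing R] {K S : Submodule R F} {α a : R}

section Generic

variable {B M : Type*} [CommRing B] [AddCommGroup M] [Module B M]

theorem mem_annihilator_quotient_iff (X Y : Submodule B M) (t : B) :
    t ∈ Module.annihilator B (Y ⧸ X.submoduleOf Y) ↔ ∀ y ∈ Y, t • y ∈ X := by
  rw [Module.mem_annihilator, (Submodule.mkQ_surjective _).forall]
  refine ⟨fun h y hy => ?_, fun h y => ?_⟩
  · have := h ⟨y, hy⟩
    rw [← map_smul, Submodule.mkQ_apply, Submodule.Quotient.mk_eq_zero] at this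
    exact this
  · rw [← map_smul, Submodule.mkQ_apply, Submodule.Quotient.mk_eq_zero]
    exact h y y.2

/-- Already over `A` any nonzero `q` generates `M`, so each `b` acts on `q`, hence on all of `M`, as
an element of `A`. -/
theorem isMaximal_annihilator_of_length_eq_one (A : Type*) [CommRing A] [Algebra A B] [Module A M]
    [IsScalarTower A B M] (h : Module.length A M = 1) : (Module.annihilator B M).IsMaximal ∧
      Function.Surjective (algebraMap A (B ⧸ Module.annihilator B M)) := by
  have hs := Module.length_eq_one_iff.1 h
  rw [isSimpleModule_iff_toSpanSingleton_surjective] at hs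
  obtain ⟨hn, hs⟩ := hs
  have hB : IsSimpleModule B M := by
    rw [isSimpleModule_iff_toSpanSingleton_surjective]
    refine ⟨hn, fun x hx y => ?_⟩
    obtain ⟨r, hr⟩ := hs x hx y
    refine ⟨algebraMap A B r, ?_⟩
    rw [← hr]
    exact algebraMap_smul B r x
  refine ⟨IsSimpleModule.annihilator_isMaximal, fun b => ?_⟩
  obtain ⟨b, rfl⟩ := Ideal.Quotient.mk_surjective b
  obtain ⟨q, hq⟩ := exists_ne (0 : M)
  obtain ⟨r, hr⟩ := hs q hq (b • q)
  refine ⟨r, ?_⟩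
  change Ideal.Quotient.mk _ (algebraMap A B r) = _
  rw [Ideal.Quotient.eq, Module.mem_annihilator]
  intro q'
  obtain ⟨r', rfl⟩ := hs q hq q'
  rw [LinearMap.toSpanSingleton_apply, ← algebraMap_smul B r' q, smul_comm, sub_smul]
  rw [LinearMap.toSpanSingleton_apply] at hr
  rw [algebraMap_smul, algebraMap_smul, hr, sub_self, smul_zero]

end Generic

/-- A homomorphism from an ideal of a finite birational extension to an injective quotient of the
total ring of fractions is given by multiplication. -/
theorem exists_eq_mul_ideal {E : Type u} [AddCommGroup E] [Module R E] [Module.Injective R E]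
    (π : F →ₗ[R] E) (hπ : Function.Surjective π) (B : Subalgebra R F) [Module.Finite R B]
    (J : Ideal B) (φ : J →ₗ[R] E) : ∃ f : F, ∀ x : J, φ x = π (f * (x : B)) := by
  have : IsNoetherian R B := isNoetherian_of_isNoetherianRing_of_finite R _
  have : IsNoetherian R J := isNoetherian_submodule' (J.restrictScalars R)
  let ι : J →ₗ[R] F := B.val.toLinearMap ∘ₗ J.subtype.restrictScalars R
  have hι : Function.Injective ι := Subtype.val_injective.comp Subtype.val_injective
  obtain ⟨f, hf⟩ := exists_eq_mul π hπ (LinearMap.range ι) (Module.Finite.iff_fg.1 inferInstance)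
    (φ ∘ₗ (LinearEquiv.ofInjective ι hι).symm.toLinearMap)
  refine ⟨f, fun x => ?_⟩
  have h := hf (LinearEquiv.ofInjective ι hι x)
  rw [LinearMap.comp_apply, LinearEquiv.coe_coe, LinearEquiv.symm_apply_apply] at h
  exact h

/-- The `B`-module `L² / L`. -/
abbrev QuotSpanB (K : Submodule R F) : Type u :=
  ↥(spanB K ^ 2) ⧸ (spanB K).submoduleOf (spanB K ^ 2)

/-- The annihilator of `L² / L`. -/
abbrev annB (K : Submodule R F) : Ideal (algB (R := R) F) :=
  Module.annihilator (algB (R := R) F) (QuotSpanB K)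

theorem mem_annB_iff (t : algB (R := R) F) :
    t ∈ annB K ↔ ∀ x ∈ spanB K ^ 2, (t : F) * x ∈ spanB K :=
  mem_annihilator_quotient_iff _ _ t

theorem smul_mem_spanB (b : algB (R := R) F) {x : F} (hx : x ∈ spanB K) :
    (b : F) * x ∈ spanB K := (spanB K).smul_mem b hx

namespace TwoAGLData

variable (D : TwoAGLData K S α a)
include D

theorem one_mem_spanB : (1 : F) ∈ spanB K := Submodule.subset_span D.one_mem

theorem coe_mem_spanB (b : algB (R := R) F) : (b : F) ∈ spanB K := by
  have := smul_mem_spanB b D.one_mem_spanB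
  rwa [mul_one] at this

theorem spanB_le_sq : spanB K ≤ spanB K ^ 2 := by
  intro x hx
  rw [sq, ← mul_one x]
  exact Submodule.mul_mem_mul hx D.one_mem_spanB

theorem relLength_spanB : relLength K ((spanB K).restrictScalars R) = 1 := by
  obtain ⟨l, hl, hlK⟩ := SetLike.not_le_iff_exists.1 D.not_spanB_le
  have hl' := (D.mem_spanB_iff l).1 hl
  exact relLength_eq_one hl hlK hl' fun y hy =>
    D.dualizing.exists_sub_smul_mem hlK hl' ((D.mem_spanB_iff y).1 hy)

theorem relLength_spanB_S : relLength ((spanB K).restrictScalars R) S = 1 := by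
  have h := relLength_add (le_spanB K) D.spanB_le
  rw [D.length_eq, D.relLength_spanB, ← one_add_one_eq_two] at h
  exact (ENat.add_right_injective_of_ne_top ENat.one_ne_top h).symm

theorem sq_le : (spanB K ^ 2).restrictScalars R ≤ S := by
  intro x hx
  have hx' : x ∈ spanB K * spanB K := by
    rw [← sq]
    exact hx
  clear hx
  induction hx' using Submodule.mul_induction_on' with
  | mem_mul_mem m hm n hn => exact D.mul_le (Submodule.mul_mem_mul (D.spanB_le hm) (D.spanB_le hn))
  | add x _ y _ h h' => exact add_mem h h'

/-- Otherwise `L` is closed under multiplication and contains `K`, hence contains `S`, although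
`S/L` has length one. -/
theorem not_sq_le : ¬ spanB K ^ 2 ≤ spanB K := by
  intro h
  have h1 : S ≤ (spanB K).restrictScalars R := by
    apply D.le_of_mul_le _ (le_spanB K)
    rw [Submodule.mul_le]
    intro x hx y hy
    apply h
    rw [sq]
    exact Submodule.mul_mem_mul hx hy
  have h2 := D.relLength_spanB_S
  rw [relLength_eq_zero_iff.2 h1] at h2
  exact zero_ne_one h2

/-- `L ⊊ L² ⊆ S` and `S/L` has length one, so `L² = S`. -/
theorem relLength_sq :
    relLength ((spanB K).restrictScalars R) ((spanB K ^ 2).restrictScalars R) = 1 ∧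
      S ≤ (spanB K ^ 2).restrictScalars R := by
  have h := relLength_add (X := (spanB K).restrictScalars R) D.spanB_le_sq D.sq_le
  rw [D.relLength_spanB_S] at h
  have h1 : relLength ((spanB K).restrictScalars R) ((spanB K ^ 2).restrictScalars R) ≠ 0 := by
    rw [Ne, relLength_eq_zero_iff]
    exact D.not_sq_le
  have h2 : relLength ((spanB K).restrictScalars R) ((spanB K ^ 2).restrictScalars R) = 1 := by
    apply le_antisymm
    · rw [h]
      exact le_self_add
    · exact Order.one_le_iff_ne_zero.2 h1
  refine ⟨h2, ?_⟩
  rw [h2] at h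
  rw [← relLength_eq_zero_iff]
  have h3 : (1 : ℕ∞) + 0 = 1 + relLength ((spanB K ^ 2).restrictScalars R) S := by
    rw [add_zero]
    exact h
  exact (ENat.add_right_injective_of_ne_top ENat.one_ne_top h3).symm

theorem length_quotSpanB : Module.length R (QuotSpanB K) = 1 := by
  rw [← D.relLength_sq.1]
  exact (Submodule.Quotient.restrictScalarsEquiv R
    ((spanB K).submoduleOf (spanB K ^ 2))).length_eq.symm

theorem sq_mul_sq : spanB K ^ 2 * spanB K ^ 2 ≤ spanB K ^ 2 := by
  rw [Submodule.mul_le]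
  intro x hx y hy
  exact D.relLength_sq.2 (D.mul_le (Submodule.mul_mem_mul (D.sq_le hx) (D.sq_le hy)))

theorem isNoetherianRing_algB : IsNoetherianRing (algB (R := R) F) := by
  have := D.finite_algB
  exact IsNoetherianRing.of_finite R _

theorem finite_of_restrictScalars_le (X : Submodule (algB (R := R) F) F)
    (h : X.restrictScalars R ≤ S) : Module.Finite (algB (R := R) F) X := by
  have hS : Module.Finite R S := Module.Finite.iff_fg.2 D.fg
  have hS' : IsNoetherian R S := isNoetherian_of_isNoetherianRing_of_finite R S
  have : Module.Finite R (X.restrictScalars R) :=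
    Module.Finite.of_injective (Submodule.inclusion h) (Submodule.inclusion_injective h)
  have : Module.Finite R X := this
  exact Module.Finite.of_restrictScalars_finite R (algB (R := R) F) X

theorem isMaximal_annB : (annB K).IsMaximal ∧
    Function.Surjective (algebraMap R (algB (R := R) F ⧸ annB K)) :=
  isMaximal_annihilator_of_length_eq_one R D.length_quotSpanB

theorem comap_eq_maximalIdeal (N : Ideal (algB (R := R) F)) [N.IsMaximal] :
    N.comap (algebraMap R (algB (R := R) F)) = maximalIdeal R := by
  have := D.finite_algB
  exact eq_maximalIdeal (Ideal.isMaximal_comap_of_isIntegral_of_isMaximal N)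

theorem algebraMap_mem (N : Ideal (algB (R := R) F)) [N.IsMaximal] {r : R}
    (hr : r ∈ maximalIdeal R) : algebraMap R (algB (R := R) F) r ∈ N := by
  rw [← D.comap_eq_maximalIdeal N] at hr
  exact hr

theorem nonempty_algEquiv :
    Nonempty ((R ⧸ maximalIdeal R) ≃ₐ[R] (algB (R := R) F ⧸ annB K)) := by
  obtain ⟨hmax, hsurj⟩ := D.isMaximal_annB
  let φ : (R ⧸ maximalIdeal R) →ₐ[R] (algB (R := R) F ⧸ annB K) :=
    Ideal.Quotient.liftₐ (maximalIdeal R) (Algebra.ofId R _) (by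
      intro r hr
      exact Ideal.Quotient.eq_zero_iff_mem.2 (D.algebraMap_mem (annB K) hr))
  have := Ideal.Quotient.nontrivial_iff.2 hmax.ne_top
  let : Field (R ⧸ maximalIdeal R) := Ideal.Quotient.field _
  refine ⟨AlgEquiv.ofBijective φ ⟨φ.toRingHom.injective, fun y => ?_⟩⟩
  obtain ⟨r, rfl⟩ := hsurj y
  exact ⟨Ideal.Quotient.mk _ r, rfl⟩

/-- `t l L ⊆ t L² ⊆ L`, and `L : L = B`. -/
theorem mul_mem_algB {t : algB (R := R) F} (ht : t ∈ annB K) {l : F} (hl : l ∈ spanB K) :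
    (t : F) * l ∈ algB (R := R) F := by
  apply D.mem_algB_of_mul_mem
  intro l' hl'
  rw [mul_assoc]
  apply (mem_annB_iff t).1 ht
  rw [sq]
  exact Submodule.mul_mem_mul hl hl'

/-- If `t l ∉ M`, maximality gives `1 = b t l + m` with `m ∈ M`, and then `L² = M L²` because `L²`
is a ring containing `l`. The determinant trick yields `r ∈ 1 + M` with `r L² = 0`; as `1 ∈ L²`,
this means `r = 0` and `1 ∈ M`. -/
theorem mul_mem_annB {t : algB (R := R) F} (ht : t ∈ annB K) {l : F} (hl : l ∈ spanB K) :
    (⟨(t : F) * l, D.mul_mem_algB ht hl⟩ : algB (R := R) F) ∈ annB K := by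
  by_contra hu
  have hmax := D.isMaximal_annB.1
  obtain ⟨b, m, hm, hbm⟩ := hmax.exists_inv hu
  have hfin := D.finite_of_restrictScalars_le _ D.sq_le
  have hle : spanB K ^ 2 ≤ annB K • (spanB K ^ 2) := by
    intro x hx
    have h1 : x = t • (l * (b * x)) + m • x := by
      have h2 := congrArg Subtype.val hbm
      change (b : F) * (t * l) + m = 1 at h2
      change x = (t : F) * (l * (b * x)) + m * x
      linear_combination (- x) * h2
    rw [h1]
    refine add_mem (Submodule.smul_mem_smul ht ?_) (Submodule.smul_mem_smul hm hx)
    exact D.sq_mul_sq (Submodule.mul_mem_mul (D.spanB_le_sq hl)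
      ((spanB K ^ 2).smul_mem b hx))
  obtain ⟨r, hr, hr0⟩ := Submodule.exists_sub_one_mem_and_smul_eq_zero_of_fg_of_le_smul _ _
    (Module.Finite.iff_fg.1 hfin) hle
  have h1 := hr0 1 (D.spanB_le_sq D.one_mem_spanB)
  have h2 : r = 0 := by
    ext
    change (r : F) * 1 = 0 at h1
    rwa [mul_one] at h1
  rw [h2, zero_sub, neg_mem_iff] at hr
  exact hmax.ne_top ((Ideal.eq_top_iff_one _).2 hr)

theorem injective_fractions : Module.Injective (algB (R := R) F) F := by
  have := D.dualizing.injective_fractions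
  have := D.finite_algB
  have := D.isNoetherianRing_algB
  apply Module.Baer.injective
  intro J φ
  obtain ⟨f, hf⟩ := exists_eq_mul_ideal (LinearMap.id : F →ₗ[R] F) Function.surjective_id _ J
    (φ.restrictScalars R)
  refine ⟨LinearMap.toSpanSingleton _ F f, fun x hx => ?_⟩
  have h := hf ⟨x, hx⟩
  change (x : F) * f = _
  rw [mul_comm]
  exact h.symm

/-- Multiplication by `α` induces `F/L → F/K`. Composed with it, `φ` becomes multiplication by some
`f`, because `F/K` is injective over `R`; the `B`-linear extension of `φ` is then multiplication by
`f/α`. -/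
theorem injective_quotient_spanB : Module.Injective (algB (R := R) F) (F ⧸ spanB K) := by
  have := D.dualizing.injective
  have := D.finite_algB
  have := D.isNoetherianRing_algB
  apply Module.Baer.injective
  intro J φ
  let ρ : (F ⧸ (spanB K).restrictScalars R) →ₗ[R] (F ⧸ K) :=
    Submodule.mapQ _ _ (LinearMap.lsmul R F α) fun x hx => by
      have := (D.mem_spanB_iff_forall_mul x).1 hx 1 (algB (R := R) F).one_mem
      rwa [mul_one] at this
  obtain ⟨f, hf⟩ := exists_eq_mul_ideal K.mkQ K.mkQ_surjective _ J
    (ρ ∘ₗ (Submodule.Quotient.restrictScalarsEquiv R (spanB K)).symm.toLinearMap ∘ₗ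
      φ.restrictScalars R)
  have key : ∀ (x : J) (y : F), (spanB K).mkQ y = φ x → α • y - f * (x : algB (R := R) F) ∈ K := by
    intro x y hy
    have h := hf x
    change ρ ((Submodule.Quotient.restrictScalarsEquiv R (spanB K)).symm (φ x)) = _ at h
    rw [← hy] at h
    change K.mkQ (α • y) = K.mkQ (f * (x : algB (R := R) F)) at h
    rwa [← sub_eq_zero, ← map_sub, Submodule.mkQ_apply, Submodule.Quotient.mk_eq_zero] at h
  obtain ⟨d, hd⟩ := D.exists_inv
  refine ⟨LinearMap.toSpanSingleton _ _ ((spanB K).mkQ (d * f)), fun x hx => ?_⟩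
  obtain ⟨y, hy⟩ := (spanB K).mkQ_surjective (φ ⟨x, hx⟩)
  rw [← hy, LinearMap.toSpanSingleton_apply, ← map_smul, eq_comm, ← sub_eq_zero, ← map_sub,
    Submodule.mkQ_apply, Submodule.Quotient.mk_eq_zero, D.mem_spanB_iff_forall_mul]
  intro b hb
  -- Membership in `L = α⁻¹(K : B)` has to be tested against every `b`; the test at `b` is `key` for
  -- the element `b x`, with `b y` as a lift of its image.
  have h := key ((⟨b, hb⟩ : algB (R := R) F) • ⟨x, hx⟩) (b * y) (by
    rw [map_smul, ← hy, ← map_smul]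
    rfl)
  convert h using 1
  change α • ((y - x * (d * f)) * b) = α • (b * y) - f * (b * x)
  have hd' : ∀ z : F, α • (d * z) = z := fun z => by rw [← smul_mul_assoc, hd, one_mul]
  have h3 : (y - x * (d * f)) * b = b * y - d * (f * (b * x)) := by ring
  rw [h3, smul_sub, hd']

end TwoAGLData

end Structure

/-! ### Two facts on modules of finite length -/

section FiniteLength

theorem isFiniteLength_of_smul_eq_zero {R : Type u} [CommRing R] [IsNoetherianRing R] {c : R}
    (hc : IsFiniteLength R (R ⧸ Ideal.span {c})) (M : Type u) [AddCommGroup M] [Module R M]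
    [Module.Finite R M] (h : ∀ x : M, c • x = 0) : IsFiniteLength R M := by
  have htors : Module.IsTorsionBySet R M (Ideal.span {c}) := by
    rw [← Module.isTorsionBySet_iff_is_torsion_by_span, Module.isTorsionBySet_singleton_iff]
    exact fun x => h x
  let : Module (R ⧸ Ideal.span {c}) M := htors.module
  have : IsScalarTower R (R ⧸ Ideal.span {c}) M := htors.isScalarTower
  have : Module.Finite (R ⧸ Ideal.span {c}) M := Module.Finite.of_restrictScalars_finite R _ M
  have : IsArtinianRing (R ⧸ Ideal.span {c}) :=
    have := (isFiniteLength_iff_isNoetherian_isArtinian.1 hc).2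
    isArtinian_of_tower R inferInstance
  have : IsArtinian R M := isArtinian_of_surjective_algebraMap (R := R ⧸ Ideal.span {c})
    Ideal.Quotient.mk_surjective
  exact isFiniteLength_iff_isNoetherian_isArtinian.2
    ⟨isNoetherian_of_isNoetherianRing_of_finite R M, this⟩

theorem surjective_of_injective_of_length_le {R M N : Type*} [CommRing R] [AddCommGroup M]
    [Module R M] [AddCommGroup N] [Module R N] (hM : IsFiniteLength R M) (f : M →ₗ[R] N)
    (hf : Function.Injective f) (h : Module.length R N ≤ Module.length R M) :
    Function.Surjective f := by
  have h1 := Module.length_eq_add_of_exact f (LinearMap.range f).mkQ hf (Submodule.mkQ_surjective _)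
    (LinearMap.exact_map_mkQ_range f)
  have hne := Module.length_ne_top_iff.2 hM
  have h2 : Module.length R (N ⧸ LinearMap.range f) = 0 := by
    apply le_antisymm _ zero_le
    rw [h1] at h
    by_contra hlt
    rw [not_le] at hlt
    have := (ENat.add_right_injective_of_ne_top hne).ne hlt.ne'
    exact this (le_antisymm (by simpa using h) (by simp))
  rw [Module.length_eq_zero_iff, Submodule.Quotient.subsingleton_iff] at h2
  exact LinearMap.range_eq_top.1 h2

end FiniteLength

/-! ### The socle of `F/L` at a maximal ideal of `B` -/

section Structure

open IsLocalRing

variable {R : Type u} [CommRing R] [IsLocalRing R] {F : Type u} [CommRing F] [Algebra R F]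
  [IsFractionRing R F] [IsNoetherianRing R] {K S : Submodule R F} {α a : R}

namespace TwoAGLData

variable (D : TwoAGLData K S α a)
include D

/-- By biduality `N ≠ B` gives `K : N ⊄ K : B`; dividing an element of the difference by `α` gives
`x`. -/
theorem exists_notMem_spanB (N : Ideal (algB (R := R) F)) [hN : N.IsMaximal] :
    ∃ x : F, x ∉ spanB K ∧ ∀ n ∈ N, (n : F) * x ∈ spanB K := by
  have hfin := D.finite_algB
  have hnoe : IsNoetherian R (algB (R := R) F) := isNoetherian_of_isNoetherianRing_of_finite R _
  let N' : Submodule R F := (N.restrictScalars R).map (algB (R := R) F).val.toLinearMap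
  have hN' : N'.FG := Submodule.FG.map _ (IsNoetherian.noetherian _)
  have hne : ¬ K / N' ≤ K / Subalgebra.toSubmodule (algB (R := R) F) := by
    intro hle
    apply hN.ne_top
    rw [Ideal.eq_top_iff_one]
    have h1 : (1 : F) ∈ K / (K / N') := by
      rw [Submodule.mem_div_iff_forall_mul_mem]
      intro g hg
      rw [mul_comm]
      exact Submodule.mem_div_iff_forall_mul_mem.1 (hle hg) 1 (algB (R := R) F).one_mem
    rw [D.dualizing.div_div _ hN'] at h1
    obtain ⟨n, hn, h⟩ := h1
    have : n = 1 := Subtype.ext h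
    rw [← this]
    exact hn
  obtain ⟨g, hg, hgB⟩ := SetLike.not_le_iff_exists.1 hne
  obtain ⟨d, hd⟩ := D.exists_inv
  have hd' : ∀ z : F, α • (d * z) = z := fun z => by rw [← smul_mul_assoc, hd, one_mul]
  refine ⟨d * g, fun h => hgB ?_, fun n hn => ?_⟩
  · rw [Submodule.mem_div_iff_forall_mul_mem]
    intro b hb
    have := (D.mem_spanB_iff_forall_mul _).1 h b hb
    rwa [mul_assoc, hd'] at this
  · rw [D.mem_spanB_iff_forall_mul]
    intro b hb
    have h1 : α • (n * (d * g) * b) = g * (n * b) := by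
      rw [show (n : F) * (d * g) * b = d * (g * (n * b)) by ring, hd']
    rw [h1]
    refine Submodule.mem_div_iff_forall_mul_mem.1 hg _ ?_
    exact ⟨n * ⟨b, hb⟩, N.mul_mem_right _ hn, rfl⟩

/-- The socle of `F / L` at `N` is cyclic. -/
theorem exists_sub_mul_mem_spanB (N : Ideal (algB (R := R) F)) [hN : N.IsMaximal] {x : F}
    (hx : x ∉ spanB K) (hNx : ∀ n ∈ N, (n : F) * x ∈ spanB K) {y : F}
    (hNy : ∀ n ∈ N, (n : F) * y ∈ spanB K) :
    ∃ b : algB (R := R) F, y - b * x ∈ spanB K := by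
  have hfin := D.finite_algB
  have hV : IsFiniteLength R (algB (R := R) F ⧸ N) := by
    refine isFiniteLength_of_smul_eq_zero (D.isFiniteLength a D.regular) _ fun z => ?_
    obtain ⟨z, rfl⟩ := Ideal.Quotient.mk_surjective z
    rw [← algebraMap_smul (algB (R := R) F) a]
    exact Ideal.Quotient.eq_zero_iff_mem.2 (N.mul_mem_right _ (D.algebraMap_mem N D.mem))
  let N' : Submodule R (algB (R := R) F) := N.restrictScalars R
  let μ : F → (algB (R := R) F →ₗ[R] (F ⧸ K)) := fun t =>
    K.mkQ ∘ₗ LinearMap.lsmul R F α ∘ₗ LinearMap.mulLeft R t ∘ₗ (algB (R := R) F).val.toLinearMap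
  have hμ0 : ∀ t, μ t = 0 ↔ t ∈ spanB K := by
    intro t
    rw [D.mem_spanB_iff_forall_mul, LinearMap.ext_iff]
    refine ⟨fun h b hb => (Submodule.Quotient.mk_eq_zero _).1 (h ⟨b, hb⟩),
      fun h b => (Submodule.Quotient.mk_eq_zero _).2 (h b b.2)⟩
  have hμN : ∀ t, (∀ n ∈ N, (n : F) * t ∈ spanB K) → N' ≤ LinearMap.ker (μ t) := by
    intro t ht n hn
    have := (D.mem_spanB_iff_forall_mul _).1 (ht n hn) 1 (algB (R := R) F).one_mem
    rw [mul_one, mul_comm] at this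
    exact (Submodule.Quotient.mk_eq_zero _).2 this
  have hbx : ∀ b : algB (R := R) F, ∀ n ∈ N, (n : F) * (b * x) ∈ spanB K := by
    intro b n hn
    rw [mul_left_comm]
    exact smul_mem_spanB b (hNx n hn)
  -- The map `b ↦ (c ↦ α b x c mod K)` has kernel `N`, so it embeds `B/N` into `Hom_R(B/N, F/K)`,
  -- whose length is at most that of `B/N`. It is therefore onto, and `b` is a preimage of the
  -- homomorphism defined by `y`.
  let Θ : algB (R := R) F →ₗ[R] ((algB (R := R) F ⧸ N') →ₗ[R] (F ⧸ K)) :=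
    { toFun b := N'.liftQ (μ (b * x)) (hμN _ (hbx b))
      map_add' b b' := by
        apply Submodule.linearMap_qext
        ext c
        change K.mkQ (α • (((b : F) + b') * x * c)) =
          K.mkQ (α • (b * x * c)) + K.mkQ (α • (b' * x * c))
        rw [← map_add, ← smul_add]
        congr 2
        ring
      map_smul' r b := by
        apply Submodule.linearMap_qext
        ext c
        change K.mkQ (α • ((r • (b : F)) * x * c)) = r • K.mkQ (α • (b * x * c))
        rw [← map_smul, smul_mul_assoc, smul_mul_assoc, smul_comm] }
  have hΘ0 : ∀ b, Θ b = 0 ↔ b ∈ N := by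
    intro b
    have h1 : Θ b = 0 ↔ (b : F) * x ∈ spanB K := by
      rw [← hμ0]
      constructor
      · intro h
        have h2 := congrArg (fun φ => φ ∘ₗ N'.mkQ) h
        rwa [LinearMap.zero_comp, show Θ b ∘ₗ N'.mkQ = μ (b * x) from N'.liftQ_mkQ _ _] at h2
      · intro h
        apply Submodule.linearMap_qext
        rw [LinearMap.zero_comp, ← h]
        exact N'.liftQ_mkQ _ _
    rw [h1]
    refine ⟨fun h => ?_, fun h => hNx b h⟩
    by_contra hb
    obtain ⟨c, n, hn, hcn⟩ := hN.exists_inv hb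
    apply hx
    have h2 := congrArg Subtype.val hcn
    change (c : F) * b + n = 1 at h2
    have h3 : x = c * (b * x) + n * x := by linear_combination (- x) * h2
    rw [h3]
    exact add_mem (smul_mem_spanB c h) (hNx n hn)
  let Θ' : (algB (R := R) F ⧸ N') →ₗ[R] ((algB (R := R) F ⧸ N') →ₗ[R] (F ⧸ K)) :=
    N'.liftQ Θ fun b hb => (hΘ0 b).2 hb
  have hinj : Function.Injective Θ' := by
    rw [injective_iff_map_eq_zero]
    intro z hz
    obtain ⟨b, rfl⟩ := N'.mkQ_surjective z
    exact (Submodule.Quotient.mk_eq_zero _).2 ((hΘ0 b).1 hz)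
  have hV' : IsFiniteLength R (algB (R := R) F ⧸ N') := hV
  obtain ⟨b, hb⟩ := surjective_of_injective_of_length_le hV' Θ' hinj
    (length_hom_le D.dualizing.socle _ hV') (N'.liftQ (μ y) (hμN y hNy))
  obtain ⟨b, rfl⟩ := N'.mkQ_surjective b
  refine ⟨b, ?_⟩
  have h1 : μ (b * x) = μ y := by
    have h2 := congrArg (fun φ => φ ∘ₗ N'.mkQ) hb
    exact h2
  rw [← hμ0]
  ext c
  have h3 := LinearMap.congr_fun h1 c
  change K.mkQ (α • (b * x * c)) = K.mkQ (α • (y * c)) at h3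
  change K.mkQ (α • ((y - b * x) * c)) = 0
  rw [sub_mul, smul_sub, map_sub, h3, sub_self]

end TwoAGLData

end Structure

/-! ### Length after localization of a flat base change -/

section Length

open IsLocalRing TensorProduct

/-- The cokernel of `h` is killed by `t`, a unit at `𝔪T`, so `h` becomes an isomorphism there. The
localization of `T` is flat over `R` with maximal ideal generated by `𝔪`, so base change to it
preserves length. -/
theorem length_localizedModule_of_injective {R T V M : Type u} [CommRing R] [IsLocalRing R]
    [CommRing T] [Algebra R T] [Module.Flat R T] [AddCommGroup V] [Module R V] [AddCommGroup M]
    [Module T M] [((maximalIdeal R).map (algebraMap R T)).IsPrime] (h : T ⊗[R] V →ₗ[T] M)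
    (hinj : Function.Injective h) (t : T) (ht : t ∉ (maximalIdeal R).map (algebraMap R T))
    (hsurj : ∀ y, ∃ z, h z = t • y) :
    Module.length (Localization.AtPrime ((maximalIdeal R).map (algebraMap R T)))
      (LocalizedModule ((maximalIdeal R).map (algebraMap R T)).primeCompl M) =
      Module.length R V := by
  let p := (maximalIdeal R).map (algebraMap R T)
  let Tp := Localization.AtPrime p
  have hmap : (maximalIdeal R).map (algebraMap R Tp) = maximalIdeal Tp := by
    rw [IsScalarTower.algebraMap_eq R T Tp, ← Ideal.map_map]
    exact Localization.AtPrime.map_eq_maximalIdeal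
  have hloc : IsLocalHom (algebraMap R Tp) := by
    refine ⟨fun r hr => ?_⟩
    by_contra h
    have h1 : algebraMap R Tp r ∈ maximalIdeal Tp := by
      rw [← hmap]
      exact Ideal.mem_map_of_mem _ h
    exact h1 hr
  have hflat : Module.Flat T Tp := IsLocalization.flat Tp p.primeCompl
  have hflat' : Module.Flat R Tp := Module.Flat.trans R T Tp
  have hbij : Function.Bijective (LocalizedModule.map p.primeCompl h) := by
    refine ⟨LocalizedModule.map_injective _ _ hinj, fun y => ?_⟩
    induction y using LocalizedModule.induction_on with
    | h y s =>
      obtain ⟨z, hz⟩ := hsurj y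
      refine ⟨LocalizedModule.mk z (⟨t, ht⟩ * s), ?_⟩
      rw [LocalizedModule.map_mk, hz]
      exact LocalizedModule.mk_cancel_common_left (⟨t, ht⟩ : p.primeCompl) s y
  have e₁ := LinearEquiv.ofBijective _ hbij
  have e₂ := LocalizedModule.equivTensorProduct p.primeCompl (T ⊗[R] V)
  have e₃ := AlgebraTensorModule.cancelBaseChange R T Tp Tp V
  have h1 : Module.length Tp (Tp ⧸ (maximalIdeal R).map (algebraMap R Tp)) = 1 := by
    rw [hmap, Module.length_eq_one_iff]
    exact isSimpleModule_iff_quot_maximal.2 ⟨_, inferInstance, ⟨LinearEquiv.refl _ _⟩⟩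
  have h2 := IsLocalRing.length_baseChange R Tp V
  rw [h1, mul_one] at h2
  rw [← h2]
  exact (e₁.symm.trans (e₂.trans e₃)).length_eq

end Length

/-! ### Rees algebras and their ideals, degree by degree -/

section Rees

variable {R : Type u} [CommRing R]

theorem coeff_mem_of_mem_map (J Q : Ideal R) {r : reesAlgebra Q}
    (hr : r ∈ J.map (algebraMap R (reesAlgebra Q))) (i : ℕ) :
    (r : R[X]).coeff i ∈ J * Q ^ i := by
  induction hr using Submodule.span_induction generalizing i with
  | mem r hr =>
    obtain ⟨x, hx, rfl⟩ := hr
    change (Polynomial.C x).coeff i ∈ _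
    rw [Polynomial.coeff_C]
    split_ifs with h
    · rw [h, pow_zero, Ideal.one_eq_top, Ideal.mul_top]
      exact hx
    · exact zero_mem _
  | zero => simp
  | add r s _ _ h h' =>
    change ((r : R[X]) + s).coeff i ∈ _
    rw [Polynomial.coeff_add]
    exact add_mem (h i) (h' i)
  | smul t r _ h =>
    change ((t : R[X]) * r).coeff i ∈ _
    rw [Polynomial.coeff_mul]
    refine sum_mem fun x hx => ?_
    rw [← Finset.HasAntidiagonal.mem_antidiagonal.1 hx, pow_add, mul_left_comm]
    exact Ideal.mul_mem_mul (t.2 _) (h _)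

/-- This is `I 𝓡(P) = ⨁ I Pⁱ tⁱ`; `Q ≤ P` makes the right side stable under `𝓡(Q)`. -/
theorem mem_mulRees_iff {I Q P : Ideal R} (hQP : Q ≤ P) (f : R[X]) :
    f ∈ mulRees I Q P ↔ ∀ i, f.coeff i ∈ I * P ^ i := by
  constructor
  · let G : Submodule (reesAlgebra Q) R[X] :=
      { carrier := {f | ∀ i, f.coeff i ∈ I * P ^ i}
        zero_mem' := by simp
        add_mem' := by
          intro f g hf hg i
          rw [Polynomial.coeff_add]
          exact add_mem (hf i) (hg i)
        smul_mem' := by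
          intro t f hf i
          change ((t : R[X]) * f).coeff i ∈ _
          rw [Polynomial.coeff_mul]
          refine sum_mem fun x hx => ?_
          rw [← Finset.HasAntidiagonal.mem_antidiagonal.1 hx, pow_add, mul_left_comm]
          exact Ideal.mul_mem_mul (Ideal.pow_right_mono hQP _ (t.2 _)) (hf _) }
    have hG : mulRees I Q P ≤ G := by
      refine Submodule.smul_le.2 fun r hr g hg i => ?_
      have hg' : ∀ j, g.coeff j ∈ P ^ j := by
        induction hg using Submodule.span_induction with
        | mem g hg => exact hg
        | zero => simp
        | add g g' _ _ h h' =>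
          intro j
          rw [Polynomial.coeff_add]
          exact add_mem (h j) (h' j)
        | smul t g _ h =>
          intro j
          change ((t : R[X]) * g).coeff j ∈ _
          rw [Polynomial.coeff_mul]
          refine sum_mem fun x hx => ?_
          rw [← Finset.HasAntidiagonal.mem_antidiagonal.1 hx, pow_add]
          exact Ideal.mul_mem_mul (Ideal.pow_right_mono hQP _ (t.2 _)) (h _)
      change ((r : R[X]) * g).coeff i ∈ _
      rw [Polynomial.coeff_mul]
      refine sum_mem fun x hx => ?_
      rw [← Finset.HasAntidiagonal.mem_antidiagonal.1 hx, pow_add, ← mul_assoc]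
      exact Ideal.mul_mem_mul (Ideal.mul_mono_right (Ideal.pow_right_mono hQP _)
        (coeff_mem_of_mem_map I Q hr _)) (hg' _)
    exact fun h => hG h
  · intro hf
    rw [f.as_sum_support]
    refine sum_mem fun i _ => ?_
    have hfi := hf i
    generalize f.coeff i = c at hfi
    induction hfi using Submodule.mul_induction_on' with
    | mem_mul_mem x hx y hy =>
      have h1 : Polynomial.monomial i (x * y) =
          (algebraMap R (reesAlgebra Q) x) • Polynomial.monomial i y := by
        change _ = Polynomial.C x * Polynomial.monomial i y
        rw [Polynomial.C_mul_monomial]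
      rw [h1]
      exact Submodule.smul_mem_smul (Ideal.mem_map_of_mem _ hx)
        (Submodule.subset_span (reesAlgebra.monomial_mem.2 hy))
    | add x _ y _ h h' =>
      rw [map_add]
      exact add_mem h h'

/-- The image `at` of the variable is recorded because the Sally module is compared with `𝓣 ⊗ S/K`
through powers of `at`. -/
theorem exists_algEquiv_reesAlgebra {a : R} (ha : a ∈ R⁰) :
    ∃ e : R[X] ≃ₐ[R] reesAlgebra (Ideal.span {a}),
      (e Polynomial.X : R[X]) = Polynomial.monomial 1 a := by
  have hT : (Polynomial.aeval (Polynomial.monomial 1 a) : R[X] →ₐ[R] R[X]).range =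
      reesAlgebra (Ideal.span {a}) := by
    rw [← adjoin_monomial_eq_reesAlgebra, Ideal.span, Submodule.map_span, Set.image_singleton,
      Algebra.adjoin_span, Algebra.adjoin_singleton_eq_range_aeval]
  have hinj : Function.Injective
      (Polynomial.aeval (Polynomial.monomial 1 a) : R[X] →ₐ[R] R[X]) := by
    rw [injective_iff_map_eq_zero]
    intro f hf
    ext n
    have h1 : f.comp (Polynomial.C a * Polynomial.X) = 0 := by
      rw [Polynomial.C_mul_X_eq_monomial, ← hf]
      rfl
    have h2 := congrArg (fun g => Polynomial.coeff g n) h1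
    simp only [Polynomial.comp_C_mul_X_coeff, Polynomial.coeff_zero] at h2
    rw [Polynomial.coeff_zero]
    exact (mul_right_mem_nonZeroDivisors_eq_zero_iff (pow_mem ha n)).1 h2
  refine ⟨(AlgEquiv.ofInjective _ hinj).trans (Subalgebra.equivOfEq _ _ hT), ?_⟩
  change Polynomial.aeval (Polynomial.monomial 1 a) (Polynomial.X : R[X]) = _
  rw [Polynomial.aeval_X]

end Rees

/-! ### Powers of `K` and the ring `R[K]` -/

section FractionalK

variable {R : Type u} [CommRing R] {F : Type u} [CommRing F] [Algebra R F] [IsFractionRing R F]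
  {I : Ideal R} {a : R} (ha : a ∈ R⁰)

theorem mem_fractionalK_iff (z : F) :
    z ∈ fractionalK F I ha ↔ ∃ x ∈ I, a • z = algebraMap R F x := by
  rw [mem_fractionalK]
  refine exists_congr fun x => and_congr_right fun _ => ?_
  rw [IsLocalization.eq_mk'_iff_mul_eq, Algebra.smul_def, mul_comm]

/-- `K = a⁻¹I`, hence `K ^ j = a⁻ʲ I ^ j`. -/
theorem mem_fractionalK_pow_iff (j : ℕ) (z : F) :
    z ∈ fractionalK F I ha ^ j ↔ ∃ x ∈ I ^ j, a ^ j • z = algebraMap R F x := by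
  obtain ⟨d, hd⟩ := (bijective_smul_of_mem_nonZeroDivisors F ha).2 1
  have hd1 : algebraMap R F a * d = 1 := by
    rw [← Algebra.smul_def]
    exact hd
  have hK : fractionalK F I ha = Submodule.span R {d} *
      Submodule.map (Algebra.ofId R F).toLinearMap I := by
    ext z
    rw [mem_fractionalK_iff, Submodule.mem_span_singleton_mul]
    constructor
    · rintro ⟨x, hx, h⟩
      refine ⟨_, ⟨x, hx, rfl⟩, ?_⟩
      change d * algebraMap R F x = z
      rw [← h, Algebra.smul_def]
      linear_combination z * hd1
    · rintro ⟨_, ⟨x, hx, rfl⟩, rfl⟩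
      refine ⟨x, hx, ?_⟩
      change a • (d * algebraMap R F x) = _
      rw [Algebra.smul_def]
      linear_combination algebraMap R F x * hd1
  have hdj : algebraMap R F (a ^ j) * d ^ j = 1 := by
    rw [map_pow, ← mul_pow, hd1, one_pow]
  rw [hK, mul_pow, ← Submodule.map_pow, Submodule.span_pow, Set.singleton_pow,
    Submodule.mem_span_singleton_mul]
  constructor
  · rintro ⟨_, ⟨x, hx, rfl⟩, rfl⟩
    refine ⟨x, hx, ?_⟩
    change a ^ j • (d ^ j * algebraMap R F x) = _
    rw [Algebra.smul_def]
    linear_combination algebraMap R F x * hdj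
  · rintro ⟨x, hx, h⟩
    refine ⟨_, ⟨x, hx, rfl⟩, ?_⟩
    change d ^ j * algebraMap R F x = z
    rw [← h, Algebra.smul_def]
    linear_combination z * hdj

variable (hmem : a ∈ I) {n : ℕ} (hn : I ^ (n + 1) = Ideal.span {a} * I ^ n)

include hmem in
theorem one_mem_fractionalK : (1 : F) ∈ fractionalK F I ha := by
  rw [mem_fractionalK_iff]
  exact ⟨a, hmem, by rw [Algebra.smul_def, mul_one]⟩

include hn in
theorem fractionalK_pow_succ_le : fractionalK F I ha ^ (n + 1) ≤ fractionalK F I ha ^ n := by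
  intro z hz
  rw [mem_fractionalK_pow_iff] at hz ⊢
  obtain ⟨x, hx, h⟩ := hz
  rw [hn, Ideal.mem_span_singleton_mul] at hx
  obtain ⟨y, hy, rfl⟩ := hx
  refine ⟨y, hy, (bijective_smul_of_mem_nonZeroDivisors F ha).1 ?_⟩
  change a • a ^ n • z = a • algebraMap R F y
  rw [smul_smul, ← pow_succ', h, map_mul, Algebra.smul_def]

include hmem in
theorem fractionalK_pow_mono : Monotone fun j => fractionalK F I ha ^ j := by
  apply monotone_nat_of_le_succ
  intro j z hz
  rw [pow_succ, ← mul_one z]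
  exact Submodule.mul_mem_mul hz (one_mem_fractionalK ha hmem)

include hmem hn in
-- The reduction equation is `K ^ (n + 1) ⊆ K ^ n`; as `1 ∈ K`, the powers increase and are constant
-- from `n` on, so `K ^ n` is `R[K]`.
theorem fractionalK_pow_le (j : ℕ) : fractionalK F I ha ^ j ≤ fractionalK F I ha ^ n := by
  have h1 : ∀ k, fractionalK F I ha ^ (n + k) ≤ fractionalK F I ha ^ n := by
    intro k
    induction k with
    | zero => exact le_rfl
    | succ k ih =>
      rw [← add_assoc, pow_succ]
      refine le_trans (mul_le_mul' ih le_rfl) ?_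
      rw [← pow_succ]
      exact fractionalK_pow_succ_le ha hn
  exact (fractionalK_pow_mono ha hmem (Nat.le_add_left j n)).trans (h1 j)

theorem fractionalK_pow_le_of_mul_le (j : ℕ) (T : Submodule R F) (h1 : (1 : F) ∈ T)
    (hT : fractionalK F I ha ≤ T) (hmul : T * T ≤ T) : fractionalK F I ha ^ j ≤ T := by
  induction j with
  | zero =>
    rw [pow_zero, Submodule.one_eq_span, Submodule.span_singleton_le_iff_mem]
    exact h1
  | succ j ih =>
    rw [pow_succ]
    exact (mul_le_mul' ih hT).trans hmul

end FractionalK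

/-! ### The rank of the Sally module -/

section SallyRank

open IsLocalRing TensorProduct

variable {R : Type u} [CommRing R]

/-- Elements of `R[t] ⊗ V` are polynomials in `t` with coefficients in `V`. -/
theorem exists_finsupp_tmul {T V X : Type u} [CommRing T] [Algebra R T] [AddCommGroup V]
    [Module R V] [AddCommGroup X] [Module R X] (e : R[X] ≃ₐ[R] T) (q : X →ₗ[R] V)
    (hq : Function.Surjective q) (z : T ⊗[R] V) :
    ∃ s : ℕ →₀ X, z = s.sum fun i x => (e Polynomial.X ^ i) ⊗ₜ[R] q x := by
  have hadd : ∀ z z' : T ⊗[R] V,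
      (∃ s : ℕ →₀ X, z = s.sum fun i x => (e Polynomial.X ^ i) ⊗ₜ[R] q x) →
      (∃ s : ℕ →₀ X, z' = s.sum fun i x => (e Polynomial.X ^ i) ⊗ₜ[R] q x) →
      ∃ s : ℕ →₀ X, z + z' = s.sum fun i x => (e Polynomial.X ^ i) ⊗ₜ[R] q x := by
    rintro _ _ ⟨s, rfl⟩ ⟨s', rfl⟩
    refine ⟨s + s', (Finsupp.sum_add_index' ?_ ?_).symm⟩
    · intro i
      rw [map_zero, tmul_zero]
    · intro i x y
      rw [map_add, tmul_add]
  induction z using TensorProduct.induction_on with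
  | zero => exact ⟨0, Finsupp.sum_zero_index.symm⟩
  | add z z' h h' => exact hadd z z' h h'
  | tmul t v =>
    obtain ⟨f, rfl⟩ := e.surjective t
    induction f using Polynomial.induction_on' with
    | add f g h h' =>
      rw [map_add, add_tmul]
      exact hadd _ _ h h'
    | monomial i r =>
      obtain ⟨x, rfl⟩ := hq v
      refine ⟨Finsupp.single i (r • x), ?_⟩
      rw [Finsupp.sum_single_index (by rw [map_zero, tmul_zero]), map_smul,
        ← Polynomial.C_mul_X_pow_eq_monomial, ← Polynomial.smul_eq_C_mul, map_smul, map_pow,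
        smul_tmul]

variable [IsLocalRing R] {F : Type u} [CommRing F] [Algebra R F] [IsFractionRing R F]
  {I : Ideal R} {a : R}

set_option maxHeartbeats 1600000 in
/-- The rank of the Sally module is the length of `R[K] / K`. -/
theorem sallyRank_eq_relLength (ha : a ∈ R⁰) (hmem : a ∈ I) {n : ℕ}
    (hn : I ^ (n + 1) = Ideal.span {a} * I ^ n) :
    sallyRank I ha = relLength (fractionalK F I ha) (fractionalK F I ha ^ n) := by
  set K := fractionalK F I ha with hK
  set Q := Ideal.span {a} with hQ
  let T := reesAlgebra Q
  have hQI : Q ≤ I := (Ideal.span_singleton_le_iff_mem I).2 hmem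
  have hQpow : ∀ j (x : R), x ∈ I * Q ^ j ↔ ∃ y ∈ I, x = a ^ j * y := by
    intro j x
    rw [hQ, Ideal.span_singleton_pow, mul_comm, Ideal.mem_span_singleton_mul]
    exact exists_congr fun y => and_congr_right fun _ => eq_comm
  have hinj : Function.Injective (algebraMap R F) := IsFractionRing.injective R F
  have hpowinj : ∀ j, Function.Injective fun y : F => a ^ j • y := fun j =>
    (bijective_smul_of_mem_nonZeroDivisors F (pow_mem ha j)).1
  obtain ⟨e, he⟩ := exists_algEquiv_reesAlgebra ha
  let t : T := e Polynomial.X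
  have htpow : ∀ i (f : R[X]), t ^ i • f = Polynomial.monomial i (a ^ i) * f := by
    intro i f
    change ((t ^ i : T) : R[X]) * f = _
    rw [Subalgebra.coe_pow, show (t : R[X]) = Polynomial.monomial 1 a from he,
      Polynomial.monomial_pow, one_mul]
  -- the map `s ↦ a ^ (n + 1) s` from `S = K ^ n` to `I ^ (n + 1)`
  have hS : ∀ j, K ^ j ≤ K ^ n := fractionalK_pow_le ha hmem hn
  obtain ⟨τ, hτ⟩ : ∃ τ : ↥(K ^ n) →ₗ[R] R,
      ∀ s, algebraMap R F (τ s) = a ^ (n + 1) • (s : F) := by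
    let j : R →ₗ[R] F := Algebra.linearMap R F
    have hr : ∀ s : ↥(K ^ n), a ^ (n + 1) • (s : F) ∈ LinearMap.range j := by
      intro s
      have h1 : (s : F) ∈ K ^ (n + 1) := fractionalK_pow_mono ha hmem (Nat.le_succ n) s.2
      obtain ⟨x, -, hx⟩ := (mem_fractionalK_pow_iff ha _ _).1 h1
      exact ⟨x, hx.symm⟩
    refine ⟨(LinearEquiv.ofInjective j hinj).symm.toLinearMap ∘ₗ
      (LinearMap.lsmul R F (a ^ (n + 1)) ∘ₗ (K ^ n).subtype).codRestrict _ hr, fun s => ?_⟩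
    have := congrArg Subtype.val ((LinearEquiv.ofInjective j hinj).apply_symm_apply
      ⟨a ^ (n + 1) • (s : F), hr s⟩)
    exact this
  have hτI : ∀ s, τ s ∈ I ^ (n + 1) := by
    intro s
    have h1 : (s : F) ∈ K ^ (n + 1) := fractionalK_pow_mono ha hmem (Nat.le_succ n) s.2
    obtain ⟨x, hx, hx'⟩ := (mem_fractionalK_pow_iff ha _ _).1 h1
    rw [← hτ] at hx'
    rwa [hinj hx']
  -- With `τ s = a ^ (n + 1) s` and `I Q ^ (i + n) = a ^ (i + n) I`, the condition cancels to `a s ∈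
  -- I`.
  have hτK : ∀ s i, a ^ i * τ s ∈ I * Q ^ (i + n) ↔ (s : F) ∈ K := by
    intro s i
    rw [hQpow, mem_fractionalK_iff]
    refine exists_congr fun y => and_congr_right fun _ => ?_
    rw [← hinj.eq_iff, map_mul, hτ, map_mul, ← Algebra.smul_def, ← Algebra.smul_def, smul_smul,
      ← pow_add, ← add_assoc, pow_succ, mul_smul]
    exact (hpowinj (i + n)).eq_iff
  let W := R[X] ⧸ mulRees I Q Q
  let π : R[X] →ₗ[T] W := (mulRees I Q Q).mkQ
  -- In degree `j` the Sally module is `I ^ (j + 1) / a ^ j I ≅ K ^ (j + 1) / K`, which equals `K ^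
  -- n / K` for `j = n`; hence `s` goes to the class of `a ^ (n + 1) s` in degree `n`.
  let g₀ : ↥(K ^ n) →ₗ[R] SallyModule I Q :=
    { toFun s := ⟨π (Polynomial.monomial n (τ s)), Submodule.mem_map_of_mem (by
        rw [mem_mulRees_iff hQI]
        intro i
        rw [Polynomial.coeff_monomial]
        split_ifs with h
        · rw [← h, ← pow_succ']
          exact hτI s
        · exact zero_mem _)⟩
      map_add' s s' := by
        ext
        change π (Polynomial.monomial n (τ (s + s'))) =
          π (Polynomial.monomial n (τ s)) + π (Polynomial.monomial n (τ s'))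
        rw [map_add, map_add, map_add]
      map_smul' r s := by
        ext
        change π (Polynomial.monomial n (τ (r • s))) = r • π (Polynomial.monomial n (τ s))
        rw [map_smul, ← Polynomial.smul_monomial]
        exact (π.restrictScalars R).map_smul r _ }
  let g : (↥(K ^ n) ⧸ K.submoduleOf (K ^ n)) →ₗ[R] SallyModule I Q :=
    (K.submoduleOf (K ^ n)).liftQ g₀ (by
      intro s hs
      rw [LinearMap.mem_ker]
      ext
      refine (Submodule.Quotient.mk_eq_zero _).2 ?_
      rw [mem_mulRees_iff le_rfl]
      intro i
      rw [Polynomial.coeff_monomial]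
      split_ifs with h
      · have h1 := (hτK s 0).2 hs
        rw [pow_zero, one_mul, zero_add] at h1
        rw [← h]
        exact h1
      · exact zero_mem _)
  let h : T ⊗[R] (↥(K ^ n) ⧸ K.submoduleOf (K ^ n)) →ₗ[T] SallyModule I Q := g.liftBaseChange T
  have hh : ∀ s : ↥(K ^ n), ∀ i, ((h ((t ^ i) ⊗ₜ[R] (K.submoduleOf (K ^ n)).mkQ s) :
      SallyModule I Q) : W) = π (Polynomial.monomial (i + n) (a ^ i * τ s)) := by
    intro s i
    rw [LinearMap.liftBaseChange_tmul]
    change t ^ i • π (Polynomial.monomial n (τ s)) = _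
    rw [← map_smul, htpow, Polynomial.monomial_mul_monomial]
  have hprime := sallyPrime_isPrime ha
  have hflat : Module.Flat R T := Module.Flat.of_linearEquiv e.symm.toLinearEquiv
  rw [sallyRank, relLength]
  refine length_localizedModule_of_injective h ?_ (t ^ n) ?_ ?_
  · rw [injective_iff_map_eq_zero]
    intro z hz
    obtain ⟨s, rfl⟩ := exists_finsupp_tmul e _ (K.submoduleOf (K ^ n)).mkQ_surjective z
    have h1 : π (s.sum fun i x => Polynomial.monomial (i + n) (a ^ i * τ x)) = 0 := by
      have h2 := congrArg (Submodule.subtype _) hz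
      rw [Finsupp.sum, map_sum, map_sum, map_zero] at h2
      rw [Finsupp.sum, map_sum, ← h2]
      exact Finset.sum_congr rfl fun i _ => (hh (s i) i).symm
    have h2 := (mem_mulRees_iff le_rfl _).1 ((Submodule.Quotient.mk_eq_zero _).1 h1)
    refine Finset.sum_eq_zero fun i hi => ?_
    -- Distinct powers of `at` land in distinct degrees, so the coefficient in degree `i + n`
    -- isolates the `i`-th term and puts `s i` in `K`.
    have h3 := h2 (i + n)
    rw [Finsupp.sum, Polynomial.finsetSum_coeff, Finset.sum_eq_single_of_mem i hi (by
      intro j _ hj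
      rw [Polynomial.coeff_monomial, if_neg (by omega)]), Polynomial.coeff_monomial,
      if_pos rfl, hτK] at h3
    have h4 : (K.submoduleOf (K ^ n)).mkQ (s i) = 0 := (Submodule.Quotient.mk_eq_zero _).2 h3
    change _ ⊗ₜ[R] (K.submoduleOf (K ^ n)).mkQ (s i) = 0
    rw [h4, tmul_zero]
  -- If `at` were in `𝔪𝓣`, its coefficient would give `a ∈ a𝔪`, which is impossible.
  · intro ht
    have h1 : t ∈ sallyPrime Q := hprime.mem_of_pow_mem n ht
    have h2 := coeff_mem_of_mem_map (maximalIdeal R) Q h1 1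
    rw [show (t : R[X]) = Polynomial.monomial 1 a from he, Polynomial.coeff_monomial, if_pos rfl,
      pow_one, mul_comm, hQ, Ideal.mem_span_singleton_mul] at h2
    obtain ⟨y, hy, hay⟩ := h2
    have h3 : y = 1 := (mul_cancel_left_mem_nonZeroDivisors ha).1 (by rw [hay, mul_one])
    rw [h3] at hy
    exact (maximalIdeal.isMaximal R).ne_top ((Ideal.eq_top_iff_one _).2 hy)
  · rintro ⟨_, f, hf, rfl⟩
    have hf' := (mem_mulRees_iff hQI f).1 hf
    -- The coefficient lies in `I ^ (i + 1) = a ^ (i + 1) K ^ (i + 1)`, so its quotient by `a ^ (i +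
    -- 1)` lies in `K ^ n`. Multiplication by `(at) ^ n` thus carries the whole Sally module into
    -- the image of `h`.
    have hs : ∀ i, ∃ s : ↥(K ^ n), a ^ i * τ s = a ^ n * f.coeff i := by
      intro i
      obtain ⟨s, hs⟩ := (bijective_smul_of_mem_nonZeroDivisors F (pow_mem ha (i + 1))).2
        (algebraMap R F (f.coeff i))
      change a ^ (i + 1) • s = _ at hs
      have hsK : s ∈ K ^ (i + 1) := by
        rw [mem_fractionalK_pow_iff]
        refine ⟨f.coeff i, ?_, hs⟩
        rw [pow_succ']
        exact hf' i
      refine ⟨⟨s, hS _ hsK⟩, hinj ?_⟩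
      rw [map_mul, hτ, map_mul, ← hs, ← Algebra.smul_def, ← Algebra.smul_def, smul_smul, smul_smul,
        ← pow_add, ← pow_add]
      congr 2
      omega
    choose s hs using hs
    refine ⟨∑ i ∈ f.support, (t ^ i) ⊗ₜ[R] (K.submoduleOf (K ^ n)).mkQ (s i), ?_⟩
    rw [map_sum]
    ext
    rw [Submodule.coe_sum, Finset.sum_congr rfl fun i _ => hh (s i) i, ← map_sum]
    change _ = t ^ n • π f
    rw [← map_smul, htpow]
    congr 1
    conv_rhs => rw [f.as_sum_support, Finset.mul_sum]
    refine Finset.sum_congr rfl fun i _ => ?_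
    rw [hs, Polynomial.monomial_mul_monomial, add_comm]

end SallyRank

theorem injective_smul_of_injective {A C Q : Type*} [CommRing A] [AddCommGroup C] [Module A C]
    [AddCommGroup Q] [Module A Q] {f : C →ₗ[A] Q} {b : A} (hf : Function.Injective f)
    (hQ : Function.Bijective fun y : Q => b • y) : Function.Injective fun y : C => b • y := by
  intro y y' h
  apply hf
  apply hQ.1
  change b • f y = b • f y'
  rw [← map_smul, ← map_smul]
  exact congrArg f h

/-! ### Canonical modules and Gorenstein rings in dimension one -/

section Local

open IsLocalRing

variable {A : Type u} [CommRing A] [IsLocalRing A] [IsNoetherianRing A]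

theorem isMaximalCohenMacaulay_of_dim_one (hdim : ringKrullDim A = 1) {b : A}
    (hb : b ∈ maximalIdeal A) (C : Type u) [AddCommGroup C] [Module A C] [Module.Finite A C]
    [Nontrivial C] (hbC : Function.Injective fun y : C => b • y) : IsMaximalCohenMacaulay A C where
  finite := inferInstance
  exists_regular := by
    have hmem : ∀ r ∈ [b], r ∈ maximalIdeal A := by
      intro r hr
      rwa [List.mem_singleton.1 hr]
    refine ⟨[b], hmem, ?_, by simpa using hdim⟩
    exact RingTheory.Sequence.IsRegular.of_isWeaklyRegular_of_mem_maximalIdeal C hmem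
      ((RingTheory.Sequence.isWeaklyRegular_singleton_iff C b).2 hbC)

variable {C Q E : Type u} [AddCommGroup C] [Module A C] [AddCommGroup Q] [Module A Q]
    [AddCommGroup E] [Module A E] {f : C →ₗ[A] Q} {g : Q →ₗ[A] E} {b : A}

/-- A cokernel with simple socle of an embedding into an injective module exhibits a canonical
module of a one-dimensional ring. -/
theorem isCanonicalModule_of_exact (hdim : ringKrullDim A = 1) (hb : b ∈ maximalIdeal A)
    (hf : Function.Injective f) (hfg : Function.Exact f g) (hg : Function.Surjective g)
    (hQ : Function.Bijective fun y : Q => b • y) [Module.Injective A Q] [Module.Injective A E]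
    (hE : HasSimpleSocle A E) [Module.Finite A C] [Nontrivial C] : IsCanonicalModule A C where
  maximal := isMaximalCohenMacaulay_of_dim_one hdim hb C (injective_smul_of_injective hf hQ)
  injective_dim := ⟨1, hasInjectiveDimensionLE_one f g hf hfg hg⟩
  type_one := by
    refine ⟨1, hdim, ?_⟩
    have h := length_ext_one (X := A ⧸ maximalIdeal A) b f g hf hfg hg (by
      intro x
      obtain ⟨x, rfl⟩ := Ideal.Quotient.mk_surjective x
      exact Ideal.Quotient.eq_zero_iff_mem.2 (Ideal.mul_mem_right _ _ hb)) hQ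
    rw [(length_hom_eq_one_iff A E).2 hE] at h
    exact h

/-- Let `0 → C → Q → E → 0` be an exact sequence such that the socle of `E` is simple. If `A` is
a Gorenstein ring which is a submodule of `C` with `𝔪 C ⊆ 𝔪`, then `A = C`. -/
theorem surjective_of_isGorensteinLocalRing (hA : IsGorensteinLocalRing A)
    (hdim : ringKrullDim A = 1) (hb : b ∈ maximalIdeal A)
    (hf : Function.Injective f) (hfg : Function.Exact f g)
    (hQ : Function.Bijective fun y : Q => b • y) (hE : HasSimpleSocle A E)
    (i : A →ₗ[A] C) (hi : Function.Injective i)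
    (hm : ∀ r ∈ maximalIdeal A, ∀ c : C, ∃ r' ∈ maximalIdeal A, r • c = i r') :
    Function.Surjective i := by
  by_contra hsurj
  simp only [Function.Surjective, not_forall, not_exists] at hsurj
  obtain ⟨c₀, hc₀⟩ := hsurj
  have hbA : b ∈ A⁰ := by
    rw [mem_nonZeroDivisors_iff_right]
    intro x hx
    refine injective_smul_of_injective (C := A) (f := f ∘ₗ i) (hf.comp hi) hQ ?_
    change b * x = b * 0
    rw [mul_comm, hx, mul_zero]
  -- If `𝔪 = (π)`, then `π c₀ = π s` with `s ∈ A`; `π` divides the regular element `b`, so `c₀ = s`.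
  by_cases hprin : (maximalIdeal A).IsPrincipal
  · obtain ⟨π, hπ⟩ := hprin.principal
    rw [← Ideal.span] at hπ
    have hπm : π ∈ maximalIdeal A := hπ ▸ Ideal.mem_span_singleton_self π
    obtain ⟨r, hr, hr'⟩ := hm π hπm c₀
    rw [hπ, Ideal.mem_span_singleton'] at hr hb
    obtain ⟨s, rfl⟩ := hr
    obtain ⟨t, rfl⟩ := hb
    refine hc₀ s (injective_smul_of_injective hf hQ ?_)
    change (t * π) • i s = (t * π) • c₀
    rw [mul_smul, mul_smul, hr', ← map_smul i π, smul_eq_mul, mul_comm s]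
  -- the maximal ideal has two independent functionals
  have hrank : 1 < Module.finrank (ResidueField A) (CotangentSpace A) := by
    rw [← finrank_cotangentSpace_le_one_iff] at hprin
    exact not_le.1 hprin
  let β := Module.finBasis (ResidueField A) (CotangentSpace A)
  let q := (LinearMap.range (f ∘ₗ i)).mkQ
  have hq : ∀ y, q y = 0 ↔ ∃ r, f (i r) = y := fun y =>
    (Submodule.Quotient.mk_eq_zero _).trans LinearMap.mem_range
  have hqc₀ : q (f c₀) ≠ 0 := by
    intro h
    obtain ⟨r, hr⟩ := (hq _).1 h
    exact hc₀ r (hf hr)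
  have hmq : ∀ r ∈ maximalIdeal A, ∀ c, r • q (f c) = 0 := by
    intro r hr c
    obtain ⟨r', -, h⟩ := hm r hr c
    rw [← map_smul, ← map_smul, h, hq]
    exact ⟨r', rfl⟩
  let δ : ResidueField A →ₗ[A] (Q ⧸ LinearMap.range (f ∘ₗ i)) :=
    (maximalIdeal A).liftQ (LinearMap.toSpanSingleton A _ (q (f c₀))) fun r hr => hmq r hr c₀
  have hδ : δ 1 = q (f c₀) := one_smul A (q (f c₀))
  -- `δ` embeds the residue field into `Q/A` through the class of `c₀`. As `A` has finite injective
  -- dimension, each functional on `𝔪/𝔪²` followed by `δ` is multiplication by some `z`. Since `𝔪 z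
  -- ⊆ C`, the image of `z` in `E` is a socle element.
  have key : ∀ lam : CotangentSpace A →ₗ[ResidueField A] ResidueField A, ∃ z : Q,
      (∀ x : maximalIdeal A, q ((x : A) • z) = δ (lam ((maximalIdeal A).toCotangent x))) ∧
      ∀ r ∈ maximalIdeal A, r • g z = 0 := by
    intro lam
    obtain ⟨z, hz⟩ := exists_extend_maximalIdeal hbA hb (isFiniteLength_quotient_span hdim hbA)
      (f ∘ₗ i) q (hf.comp hi) (LinearMap.exact_map_mkQ_range _) (Submodule.mkQ_surjective _) hQ
      hA.injective_dim (δ ∘ₗ (lam.restrictScalars A) ∘ₗ (maximalIdeal A).toCotangent)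
    obtain ⟨z, rfl⟩ := Submodule.mkQ_surjective _ z
    have hz' : ∀ x : maximalIdeal A,
        q ((x : A) • z) = δ (lam ((maximalIdeal A).toCotangent x)) := by
      intro x
      rw [map_smul]
      exact (hz x).symm
    refine ⟨z, hz', fun r hr => ?_⟩
    have hδC : ∀ v, ∃ c, δ v = q (f c) := by
      intro v
      obtain ⟨s, rfl⟩ := residue_surjective v
      exact ⟨s • c₀, by rw [map_smul, map_smul]; rfl⟩
    obtain ⟨c, hc⟩ := hδC (lam ((maximalIdeal A).toCotangent ⟨r, hr⟩))
    rw [← hz' ⟨r, hr⟩, ← sub_eq_zero, ← map_sub, hq] at hc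
    obtain ⟨s, hs⟩ := hc
    rw [← map_smul, hfg]
    exact ⟨i s + c, by rw [map_add, hs, sub_add_cancel]⟩
  obtain ⟨w, -, hmw, hw⟩ := hE
  obtain ⟨z₀, hz₀, hgz₀⟩ := key (β.coord ⟨0, by omega⟩)
  obtain ⟨z₁, hz₁, hgz₁⟩ := key (β.coord ⟨1, hrank⟩)
  obtain ⟨x₀, hx₀⟩ := (maximalIdeal A).toCotangent_surjective (β ⟨0, by omega⟩)
  obtain ⟨x₁, hx₁⟩ := (maximalIdeal A).toCotangent_surjective (β ⟨1, hrank⟩)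
  obtain ⟨r₀, hr₀⟩ := hw _ hgz₀
  obtain ⟨r₁, hr₁⟩ := hw _ hgz₁
  have h00 : q ((x₀ : A) • z₀) = q (f c₀) := by
    rw [hz₀, hx₀, Module.Basis.coord_apply, Module.Basis.repr_self, Finsupp.single_eq_same, hδ]
  have h01 : q ((x₀ : A) • z₁) = 0 := by
    rw [hz₁, hx₀, Module.Basis.coord_apply, Module.Basis.repr_self,
      Finsupp.single_eq_of_ne (by simp), map_zero]
  have h11 : q ((x₁ : A) • z₁) = q (f c₀) := by
    rw [hz₁, hx₁, Module.Basis.coord_apply, Module.Basis.repr_self, Finsupp.single_eq_same, hδ]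
  have hC : ∀ z, g z = 0 → ∀ x ∈ maximalIdeal A, q (x • z) = 0 := by
    intro z hz x hx
    obtain ⟨c, rfl⟩ := (hfg z).1 hz
    rw [map_smul]
    exact hmq x hx c
  have hne : ∀ r, r • q (f c₀) = 0 → r ∈ maximalIdeal A := by
    intro r hr
    by_contra h
    rw [mem_maximalIdeal, mem_nonunits_iff, not_not] at h
    exact hqc₀ ((h.smul_eq_zero).1 hr)
  -- The socle of `E` is generated by `w`, so `r₀ z₁ - r₁ z₀` maps to zero in `E` and lies in `C`,
  -- which `𝔪` carries into `A`. Evaluation at the dual elements `x₀`, `x₁` then forces `r₁` and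
  -- `r₀` into `𝔪`.
  have hrel : ∀ x ∈ maximalIdeal A, r₀ • q (x • z₁) = r₁ • q (x • z₀) := by
    intro x hx
    rw [← map_smul, ← map_smul, ← sub_eq_zero, ← map_sub, smul_comm r₀, smul_comm r₁, ← smul_sub]
    refine hC _ ?_ x hx
    rw [map_sub, map_smul, map_smul, hr₀, hr₁, smul_comm, sub_self]
  have hr₁m : r₁ ∈ maximalIdeal A := by
    apply hne
    rw [← h00, ← hrel _ x₀.2, h01, smul_zero]
  have hr₀m : r₀ ∈ maximalIdeal A := by
    apply hne
    rw [← h11, hrel _ x₁.2]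
    obtain ⟨c, hc⟩ : ∃ c, f c = r₁ • z₀ := by
      rw [← Set.mem_range, ← hfg, map_smul]
      exact hgz₀ r₁ hr₁m
    rw [← map_smul, smul_comm, ← hc]
    rw [map_smul]
    exact hmq _ x₁.2 c
  -- Now `r₀ w = 0`, so `z₀ ∈ C` and `x₀ z₀ ∈ A`, although the functional of `z₀` takes the value
  -- one at `x₀`.
  refine hqc₀ ?_
  rw [← h00]
  exact hC _ (by rw [hr₀, hmw r₀ hr₀m]) _ x₀.2

omit [IsNoetherianRing A] in
theorem isAGL_of_linearMap (hA : IsCohenMacaulayLocalRing A) (hdim : ringKrullDim A = 1)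
    (hC : IsCanonicalModule A C) (i : A →ₗ[A] C) (hi : Function.Injective i)
    (hm : ∀ r ∈ maximalIdeal A, ∀ c : C, ∃ r', r • c = i r') : IsAGL A := by
  refine ⟨hA, hdim, ModuleCat.of A C, i, hC, hi, fun r hr => ?_⟩
  rw [Module.mem_annihilator]
  intro y
  obtain ⟨c, rfl⟩ := Submodule.mkQ_surjective _ y
  rw [← map_smul, Submodule.mkQ_apply, Submodule.Quotient.mk_eq_zero]
  obtain ⟨r', h⟩ := hm r hr c
  exact ⟨r', h.symm⟩

theorem isGorensteinLocalRing_of_linearEquiv (hC : IsCanonicalModule A C) (e : A ≃ₗ[A] C) :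
    IsGorensteinLocalRing A := by
  obtain ⟨n, hn⟩ := hC.injective_dim
  exact ⟨inferInstance, n, hasInjectiveDimensionLT_of_iso e.symm.toModuleIso (n + 1)⟩

end Local

/-! ### Injective modules and socles under localization -/

section Localization

open IsLocalRing

variable {B : Type u} [CommRing B]

theorem bijective_smul_localizedModule (S : Submonoid B) {X : Type u} [AddCommGroup X] [Module B X]
    {b : B} (hb : Function.Bijective fun y : X => b • y) :
    Function.Bijective fun y : LocalizedModule S X => algebraMap B (Localization S) b • y := by
  have h : (fun y : LocalizedModule S X => algebraMap B (Localization S) b • y) =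
      LocalizedModule.map S (LinearMap.lsmul B X b) := by
    ext y
    induction y using LocalizedModule.induction_on with
    | h x s =>
      rw [algebraMap_smul, LocalizedModule.map_mk, LocalizedModule.smul'_mk]
      rfl
  rw [h]
  exact ⟨LocalizedModule.map_injective S _ hb.1, LocalizedModule.map_surjective S _ hb.2⟩

theorem injective_localizedModule [IsNoetherianRing B] (S : Submonoid B) (X : Type u)
    [AddCommGroup X] [Module B X] [Module.Injective B X] :
    Module.Injective (Localization S) (LocalizedModule S X) :=
  Module.injective_of_isLocalizedModule S (LocalizedModule.mkLinearMap S X)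

theorem mk_eq_zero_iff (S : Submonoid B) {X : Type u} [AddCommGroup X] [Module B X] (x : X)
    (s : S) : LocalizedModule.mk x s = 0 ↔ ∃ t ∈ S, t • x = 0 := by
  rw [← LocalizedModule.zero_mk 1, LocalizedModule.mk_eq]
  simp only [one_smul, smul_zero]
  constructor
  · rintro ⟨t, ht⟩
    exact ⟨t, t.2, ht⟩
  · rintro ⟨t, ht, h⟩
    exact ⟨⟨t, ht⟩, h⟩

/-- If `y/s` is in the socle of the localization, finite generation of `N` gives a single `t ∉ N`
with `N t y = 0`. Then `t y` is a multiple of `x`, and so is `y/s` locally. -/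
theorem hasSimpleSocle_localizedModule [IsNoetherianRing B] (N : Ideal B) [hN : N.IsMaximal]
    {X : Type u} [AddCommGroup X] [Module B X] {x : X} (hx : x ≠ 0) (hNx : ∀ n ∈ N, n • x = 0)
    (h : ∀ y : X, (∀ n ∈ N, n • y = 0) → ∃ b : B, y = b • x) :
    HasSimpleSocle (Localization.AtPrime N) (LocalizedModule N.primeCompl X) := by
  have hzero := mk_eq_zero_iff N.primeCompl (X := X)
  refine ⟨LocalizedModule.mk x 1, ?_, ?_, ?_⟩
  · rw [Ne, hzero]
    rintro ⟨t, ht, htx⟩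
    obtain ⟨y, n, hn, hyn⟩ := hN.exists_inv ht
    apply hx
    rw [← one_smul B x, ← hyn, add_smul, mul_smul, htx, smul_zero, hNx n hn, add_zero]
  · intro r hr
    induction r using Localization.induction_on with
    | H p =>
      obtain ⟨r, s⟩ := p
      rw [Localization.mk_eq_mk', IsLocalization.AtPrime.mk'_mem_maximal_iff _ N] at hr
      rw [LocalizedModule.mk_smul_mk, hNx r hr, LocalizedModule.zero_mk]
  · intro y hy
    induction y using LocalizedModule.induction_on with
    | h y s =>
      obtain ⟨t, ht, hty⟩ : ∃ t ∉ N, ∀ n ∈ N, t • n • y = 0 := by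
        have key : ∀ J : Ideal B, J.FG → J ≤ N → ∃ t ∉ N, ∀ n ∈ J, t • n • y = 0 := by
          intro J hJ
          induction J, hJ using Submodule.fg_induction with
          | singleton z =>
            intro hz
            have hzN : z ∈ N := hz (Submodule.mem_span_singleton_self z)
            have h1 := hy (algebraMap B _ z) (by
              rw [IsLocalization.AtPrime.to_map_mem_maximal_iff _ N]
              exact hzN)
            rw [algebraMap_smul, LocalizedModule.smul'_mk, hzero] at h1
            obtain ⟨t, ht, h1⟩ := h1
            refine ⟨t, ht, fun n hn => ?_⟩
            obtain ⟨c, rfl⟩ := Submodule.mem_span_singleton.1 hn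
            rw [smul_assoc, smul_comm t, h1, smul_zero]
          | sup J₁ J₂ _ _ h₁ h₂ =>
            intro hJ
            obtain ⟨t₁, ht₁, h₁⟩ := h₁ (le_sup_left.trans hJ)
            obtain ⟨t₂, ht₂, h₂⟩ := h₂ (le_sup_right.trans hJ)
            refine ⟨t₁ * t₂, N.primeCompl.mul_mem ht₁ ht₂, fun n hn => ?_⟩
            obtain ⟨n₁, hn₁, n₂, hn₂, rfl⟩ := Submodule.mem_sup.1 hn
            rw [add_smul, smul_add, mul_smul, mul_smul, h₂ _ hn₂, smul_comm t₁, h₁ _ hn₁,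
              smul_zero, smul_zero, add_zero]
        exact key N (IsNoetherian.noetherian N) le_rfl
      obtain ⟨c, hc⟩ := h (t • y) fun n hn => by rw [smul_comm, hty n hn]
      refine ⟨Localization.mk c (⟨t, ht⟩ * s), ?_⟩
      rw [LocalizedModule.mk_smul_mk, ← hc, mul_one]
      exact (LocalizedModule.mk_cancel_common_left ⟨t, ht⟩ s y).symm

end Localization

/-! ### Dimension one -/

section Dim

open IsLocalRing

/-- A local ring has dimension one if its maximal ideal is the only prime ideal containing a given
nonzerodivisor. -/
theorem ringKrullDim_eq_one {A : Type u} [CommRing A] [IsLocalRing A] [IsNoetherianRing A] {b : A}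
    (hb : b ∈ A⁰) (hbm : b ∈ maximalIdeal A)
    (h : ∀ P : Ideal A, P.IsPrime → b ∈ P → P.IsMaximal) : ringKrullDim A = 1 := by
  have h0 : Ring.KrullDimLE 0 (A ⧸ Ideal.span {b}) := by
    refine Ring.KrullDimLE.mk₀ fun P hP => ?_
    have hP' := Ideal.comap_isPrime (Ideal.Quotient.mk (Ideal.span {b})) P
    have := h _ hP' (by
      rw [Ideal.mem_comap, Ideal.Quotient.eq_zero_iff_mem.2 (Ideal.mem_span_singleton_self b)]
      exact zero_mem P)
    have hsurj : Function.Surjective (Ideal.Quotient.mk (Ideal.span {b})) :=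
      Ideal.Quotient.mk_surjective
    rw [← Ideal.map_comap_of_surjective _ hsurj P]
    refine (Ideal.map_eq_top_or_isMaximal_of_surjective _ hsurj this).resolve_left fun htop => ?_
    rw [Ideal.map_comap_of_surjective _ hsurj P] at htop
    exact hP.ne_top htop
  have hne : Nontrivial (A ⧸ Ideal.span {b}) := by
    rw [Ideal.Quotient.nontrivial_iff, Ne, Ideal.span_singleton_eq_top]
    exact hbm
  rw [← ringKrullDim_quotient_span_singleton_succ_eq_ringKrullDim_of_mem_nonZeroDivisors hb hbm,
    ringKrullDimZero_iff_ringKrullDim_eq_zero.1 h0, zero_add]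

end Dim

/-! ### The rings `B_N` and the modules `L_N` -/

section LocalizationAtMaximal

open IsLocalRing

variable {R : Type u} [CommRing R] [IsLocalRing R] {F : Type u} [CommRing F] [Algebra R F]
  [IsFractionRing R F] [IsNoetherianRing R] {K S : Submodule R F} {α a : R}

/-- The localization of `L = B K`. -/
abbrev LocSpanB (K : Submodule R F) (N : Ideal (algB (R := R) F)) [N.IsMaximal] : Type u :=
  LocalizedModule N.primeCompl (spanB K)

namespace TwoAGLData

variable (D : TwoAGLData K S α a) (N : Ideal (algB (R := R) F)) [N.IsMaximal]
include D

/-- `B/P` is a domain of finite length over `R`, hence a field. -/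
theorem isMaximal_of_algebraMap_mem (P : Ideal (algB (R := R) F)) [P.IsPrime]
    (h : algebraMap R (algB (R := R) F) a ∈ P) : P.IsMaximal := by
  have hfin := D.finite_algB
  have h1 : IsFiniteLength R (algB (R := R) F ⧸ P) := by
    refine isFiniteLength_of_smul_eq_zero (D.isFiniteLength a D.regular) _ fun z => ?_
    obtain ⟨z, rfl⟩ := Ideal.Quotient.mk_surjective z
    rw [← algebraMap_smul (algB (R := R) F) a]
    exact Ideal.Quotient.eq_zero_iff_mem.2 (P.mul_mem_right _ h)
  have h2 : IsArtinian R (algB (R := R) F ⧸ P) :=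
    (isFiniteLength_iff_isNoetherian_isArtinian.1 h1).2
  have h3 : IsArtinianRing (algB (R := R) F ⧸ P) := isArtinian_of_tower R h2
  exact Ideal.Quotient.maximal_of_isField _ (IsArtinianRing.isField_of_isDomain _)

theorem bijective_smul_fractions :
    Function.Bijective fun y : F => algebraMap R (algB (R := R) F) a • y := by
  have h := bijective_smul_of_mem_nonZeroDivisors F D.regular
  simp only [algebraMap_smul]
  exact h

/-- The embedding of `B_N` into `L_N`. -/
def toLocSpanB : Localization.AtPrime N →ₗ[Localization.AtPrime N] LocSpanB K N :=
  LinearMap.toSpanSingleton _ _ (LocalizedModule.mk (⟨1, D.one_mem_spanB⟩ : spanB K) 1)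

theorem toLocSpanB_mk (b : algB (R := R) F) (s : N.primeCompl) :
    D.toLocSpanB N (Localization.mk b s) = LocalizedModule.mk ⟨b, D.coe_mem_spanB b⟩ s := by
  change Localization.mk b s • (LocalizedModule.mk ⟨1, D.one_mem_spanB⟩ 1 : LocSpanB K N) = _
  rw [LocalizedModule.mk_smul_mk, mul_one]
  congr 1
  ext
  exact mul_one (b : F)

theorem injective_toLocSpanB : Function.Injective (D.toLocSpanB N) := by
  rw [injective_iff_map_eq_zero]
  intro x hx
  induction x using Localization.induction_on with
  | H p =>
    obtain ⟨b, s⟩ := p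
    rw [toLocSpanB_mk, mk_eq_zero_iff] at hx
    obtain ⟨t, ht, h⟩ := hx
    have h1 : (t : F) * b = 0 := congrArg Subtype.val h
    rw [Localization.mk_eq_mk', IsLocalization.mk'_eq_zero_iff]
    exact ⟨⟨t, ht⟩, Subtype.ext h1⟩

theorem isNoetherianRing_localization : IsNoetherianRing (Localization.AtPrime N) :=
  have := D.isNoetherianRing_algB
  IsLocalization.isNoetherianRing N.primeCompl _ inferInstance

theorem injective_map_subtype :
    Function.Injective (LocalizedModule.map N.primeCompl (spanB K).subtype) :=
  LocalizedModule.map_injective _ _ (spanB K).injective_subtype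

theorem surjective_map_mkQ :
    Function.Surjective (LocalizedModule.map N.primeCompl (spanB K).mkQ) :=
  LocalizedModule.map_surjective _ _ (spanB K).mkQ_surjective

theorem exact_map : Function.Exact (LocalizedModule.map N.primeCompl (spanB K).subtype)
    (LocalizedModule.map N.primeCompl (spanB K).mkQ) :=
  LocalizedModule.map_exact _ _ _ (LinearMap.exact_subtype_mkQ _)

theorem bijective_smul_localization : Function.Bijective fun y : LocalizedModule N.primeCompl F =>
    algebraMap (algB (R := R) F) (Localization.AtPrime N)
      (algebraMap R (algB (R := R) F) a) • y :=
  bijective_smul_localizedModule _ D.bijective_smul_fractions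

theorem algebraMap_mem_maximalIdeal : algebraMap (algB (R := R) F) (Localization.AtPrime N)
    (algebraMap R (algB (R := R) F) a) ∈ maximalIdeal (Localization.AtPrime N) := by
  rw [IsLocalization.AtPrime.to_map_mem_maximal_iff _ N]
  exact D.algebraMap_mem N D.mem

theorem injective_smul_localization : Function.Injective fun y : Localization.AtPrime N =>
    algebraMap (algB (R := R) F) (Localization.AtPrime N)
      (algebraMap R (algB (R := R) F) a) • y :=
  injective_smul_of_injective
    (f := LocalizedModule.map N.primeCompl (spanB K).subtype ∘ₗ D.toLocSpanB N)
    ((D.injective_map_subtype N).comp (D.injective_toLocSpanB N)) (D.bijective_smul_localization N)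

theorem ringKrullDim_localization : ringKrullDim (Localization.AtPrime N) = 1 := by
  have := D.isNoetherianRing_localization N
  refine ringKrullDim_eq_one (b := algebraMap (algB (R := R) F) (Localization.AtPrime N)
    (algebraMap R (algB (R := R) F) a)) ?_ (D.algebraMap_mem_maximalIdeal N) fun P hP hb => ?_
  · rw [mem_nonZeroDivisors_iff_left]
    intro x hx
    apply D.injective_smul_localization N
    change _ * x = _ * 0
    rw [hx, mul_zero]
  · have hP' := Ideal.comap_isPrime (algebraMap (algB (R := R) F) (Localization.AtPrime N)) P
    have hmax := D.isMaximal_of_algebraMap_mem _ (Ideal.mem_comap.2 hb)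
    have hle : P.comap (algebraMap (algB (R := R) F) (Localization.AtPrime N)) ≤ N := by
      intro x hx
      rw [← IsLocalization.AtPrime.to_map_mem_maximal_iff (Localization.AtPrime N) N]
      exact le_maximalIdeal hP.ne_top hx
    have heq := hmax.eq_of_le (Ideal.IsMaximal.ne_top ‹_›) hle
    have hPm : P = maximalIdeal (Localization.AtPrime N) := by
      refine le_antisymm (le_maximalIdeal hP.ne_top) fun x hx => ?_
      obtain ⟨x, s, rfl⟩ := IsLocalization.exists_mk'_eq N.primeCompl x
      rw [IsLocalization.AtPrime.mk'_mem_maximal_iff _ N, ← heq] at hx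
      rw [IsLocalization.mk'_eq_mul_mk'_one]
      exact P.mul_mem_right _ hx
    rw [hPm]
    exact maximalIdeal.isMaximal _

theorem hasSimpleSocle_localization : HasSimpleSocle (Localization.AtPrime N)
    (LocalizedModule N.primeCompl (F ⧸ spanB K)) := by
  have := D.isNoetherianRing_algB
  obtain ⟨x, hx, hNx⟩ := D.exists_notMem_spanB N
  refine hasSimpleSocle_localizedModule N (x := (spanB K).mkQ x) ?_ ?_ ?_
  · rwa [Ne, Submodule.mkQ_apply, Submodule.Quotient.mk_eq_zero]
  · intro n hn
    rw [← map_smul, Submodule.mkQ_apply, Submodule.Quotient.mk_eq_zero]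
    exact hNx n hn
  · intro y hy
    obtain ⟨y, rfl⟩ := (spanB K).mkQ_surjective y
    obtain ⟨b, hb⟩ := D.exists_sub_mul_mem_spanB N hx hNx (y := y) fun n hn => by
      have := hy n hn
      rwa [← map_smul, Submodule.mkQ_apply, Submodule.Quotient.mk_eq_zero] at this
    refine ⟨b, ?_⟩
    rw [← map_smul, ← sub_eq_zero, ← map_sub, Submodule.mkQ_apply, Submodule.Quotient.mk_eq_zero]
    exact hb

/-- The sequence `0 → L_N → F_N → (F/L)_N → 0` is an injective resolution whose last term has simple
socle. -/
theorem isCanonicalModule_locSpanB :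
    IsCanonicalModule (Localization.AtPrime N) (LocSpanB K N) := by
  have := D.isNoetherianRing_algB
  have := D.isNoetherianRing_localization N
  have := D.injective_fractions
  have := D.injective_quotient_spanB
  have := injective_localizedModule N.primeCompl F
  have := injective_localizedModule N.primeCompl (F ⧸ spanB K)
  have : Module.Finite (algB (R := R) F) (spanB K) := D.finite_of_restrictScalars_le _ D.spanB_le
  have : Module.Finite (Localization.AtPrime N) (LocSpanB K N) :=
    Module.Finite.of_isLocalizedModule N.primeCompl
      (LocalizedModule.mkLinearMap N.primeCompl (spanB K))
  have : Nontrivial (LocSpanB K N) := (D.injective_toLocSpanB N).nontrivial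
  exact isCanonicalModule_of_exact (D.ringKrullDim_localization N)
    (D.algebraMap_mem_maximalIdeal N) (D.injective_map_subtype N) (D.exact_map N)
    (D.surjective_map_mkQ N) (D.bijective_smul_localization N) (D.hasSimpleSocle_localization N)

theorem isCohenMacaulayLocalRing_localization :
    IsCohenMacaulayLocalRing (Localization.AtPrime N) := by
  have := D.isNoetherianRing_localization N
  exact ⟨this, isMaximalCohenMacaulay_of_dim_one (D.ringKrullDim_localization N)
    (D.algebraMap_mem_maximalIdeal N) _ (D.injective_smul_localization N)⟩

/-- The localized form of `ML ⊆ M`; it is used both at `M` and away from `M`. -/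
theorem mul_mem_range_toLocSpanB {t : algB (R := R) F} (ht : t ∈ annB K) (s : N.primeCompl)
    (l : LocSpanB K N) : ∃ t' ∈ annB K, ∃ s', Localization.mk t s • l =
      D.toLocSpanB N (Localization.mk t' s') := by
  induction l using LocalizedModule.induction_on with
  | h l s' =>
    refine ⟨_, D.mul_mem_annB ht l.2, s * s', ?_⟩
    rw [toLocSpanB_mk, LocalizedModule.mk_smul_mk]
    rfl

/-- An element `s` of `M` outside `N` is a unit of `B_N`, and `s L ⊆ M ⊆ B`. -/
theorem surjective_toLocSpanB (hN : N ≠ annB K) : Function.Surjective (D.toLocSpanB N) := by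
  have hle : ¬ annB K ≤ N := fun h => hN (D.isMaximal_annB.1.eq_of_le
    (Ideal.IsMaximal.ne_top ‹_›) h).symm
  obtain ⟨s, hs, hsN⟩ := Set.not_subset.1 hle
  intro l
  obtain ⟨t', -, s', h⟩ := D.mul_mem_range_toLocSpanB N hs ⟨s, hsN⟩ l
  refine ⟨_, h.symm.trans ?_⟩
  rw [Localization.mk_self (⟨s, hsN⟩ : N.primeCompl), one_smul]

/-- If `L_M = B_M`, every element of `L²` is carried into `L` by some `t ∉ M`. It is also carried
into `L` by all of `M`, and `t` and `M` generate the unit ideal, so `L² ⊆ L`. -/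
theorem not_surjective_toLocSpanB [(annB K).IsMaximal] :
    ¬ Function.Surjective (D.toLocSpanB (annB K)) := by
  intro h
  have key : ∀ l ∈ spanB K, ∃ t ∉ annB K, (t : F) * l ∈ algB (R := R) F := by
    intro l hl
    obtain ⟨x, hx⟩ := h (LocalizedModule.mk ⟨l, hl⟩ 1)
    induction x using Localization.induction_on with
    | H p =>
      obtain ⟨b, s⟩ := p
      rw [toLocSpanB_mk, LocalizedModule.mk_eq] at hx
      obtain ⟨u, hu⟩ := hx
      refine ⟨u * s, (annB K).primeCompl.mul_mem u.2 s.2, ?_⟩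
      have h1 : (u : F) * ((1 : F) * b) = u * (s * l) := congrArg Subtype.val hu
      rw [one_mul, ← mul_assoc] at h1
      change (u : F) * s * l ∈ _
      rw [← h1]
      exact mul_mem u.1.2 b.2
  have hsq : ∀ x ∈ spanB K ^ 2, ∃ t ∉ annB K, (t : F) * x ∈ spanB K := by
    intro x hx
    rw [sq] at hx
    induction hx using Submodule.mul_induction_on' with
    | mem_mul_mem l hl l' hl' =>
      obtain ⟨t, ht, h⟩ := key l hl
      refine ⟨t, ht, ?_⟩
      rw [← mul_assoc]
      exact smul_mem_spanB ⟨_, h⟩ hl'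
    | add x hx y hy h h' =>
      obtain ⟨t, ht, h⟩ := h
      obtain ⟨t', ht', h'⟩ := h'
      refine ⟨t * t', (annB K).primeCompl.mul_mem ht ht', ?_⟩
      rw [mul_add]
      refine add_mem ?_ ?_
      · rw [mul_comm t, Subalgebra.coe_mul, mul_assoc]
        exact smul_mem_spanB t' h
      · rw [Subalgebra.coe_mul, mul_assoc]
        exact smul_mem_spanB t h'
  apply D.not_sq_le
  intro x hx
  obtain ⟨t, ht, htx⟩ := hsq x hx
  obtain ⟨b, m, hm, hbm⟩ := D.isMaximal_annB.1.exists_inv ht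
  have h1 : x = b * (t * x) + m * x := by
    have h2 : (b : F) * t + m = 1 := congrArg Subtype.val hbm
    linear_combination (- x) * h2
  rw [h1]
  exact add_mem (smul_mem_spanB b htx) ((mem_annB_iff m).1 hm x hx)

theorem isGorensteinLocalRing_localization (hN : N ≠ annB K) :
    IsGorensteinLocalRing (Localization.AtPrime N) := by
  have := D.isNoetherianRing_localization N
  exact isGorensteinLocalRing_of_linearEquiv (D.isCanonicalModule_locSpanB N)
    (LinearEquiv.ofBijective _ ⟨D.injective_toLocSpanB N, D.surjective_toLocSpanB N hN⟩)

theorem exists_smul_eq_toLocSpanB [(annB K).IsMaximal]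
    {r : Localization.AtPrime (annB K)} (hr : r ∈ maximalIdeal (Localization.AtPrime (annB K)))
    (l : LocSpanB K (annB K)) : ∃ r' ∈ maximalIdeal (Localization.AtPrime (annB K)),
      r • l = D.toLocSpanB (annB K) r' := by
  induction r using Localization.induction_on with
  | H p =>
    obtain ⟨t, s⟩ := p
    rw [Localization.mk_eq_mk', IsLocalization.AtPrime.mk'_mem_maximal_iff _ (annB K)] at hr
    obtain ⟨t', ht', s', h⟩ := D.mul_mem_range_toLocSpanB (annB K) hr s l
    refine ⟨_, ?_, h⟩
    rw [Localization.mk_eq_mk', IsLocalization.AtPrime.mk'_mem_maximal_iff _ (annB K)]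
    exact ht'

theorem not_isGorensteinLocalRing_localization [(annB K).IsMaximal] :
    ¬ IsGorensteinLocalRing (Localization.AtPrime (annB K)) := by
  intro h
  have := D.isNoetherianRing_localization (annB K)
  refine D.not_surjective_toLocSpanB ?_
  have h1 := D.ringKrullDim_localization (annB K)
  have h2 := D.algebraMap_mem_maximalIdeal (annB K)
  have h3 := D.injective_map_subtype (annB K)
  have h4 := D.exact_map (annB K)
  have h5 := D.bijective_smul_localization (annB K)
  have h6 := D.hasSimpleSocle_localization (annB K)
  have h7 := D.injective_toLocSpanB (annB K)
  refine surjective_of_isGorensteinLocalRing (A := Localization.AtPrime (annB K))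
    (C := LocSpanB K (annB K)) (Q := LocalizedModule (annB K).primeCompl F)
    (E := LocalizedModule (annB K).primeCompl (F ⧸ spanB K))
    (f := LocalizedModule.map (annB K).primeCompl (spanB K).subtype)
    (g := LocalizedModule.map (annB K).primeCompl (spanB K).mkQ)
    (b := algebraMap (algB (R := R) F) (Localization.AtPrime (annB K))
      (algebraMap R (algB (R := R) F) a)) h h1 h2 h3 h4 h5 h6 (D.toLocSpanB (annB K)) h7 ?_
  intro r hr l
  exact D.exists_smul_eq_toLocSpanB hr l

/-- At `M` the cokernel of `B_M → L_M` is killed by the maximal ideal because `ML ⊆ M`; at every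
other `N` it is zero. -/
theorem isAGL_localization : IsAGL (Localization.AtPrime N) := by
  refine isAGL_of_linearMap (D.isCohenMacaulayLocalRing_localization N)
    (D.ringKrullDim_localization N) (D.isCanonicalModule_locSpanB N) (D.toLocSpanB N)
    (D.injective_toLocSpanB N) fun r hr l => ?_
  by_cases hN : N = annB K
  · subst hN
    obtain ⟨r', -, h⟩ := D.exists_smul_eq_toLocSpanB hr l
    exact ⟨r', h⟩
  · obtain ⟨r', h⟩ := D.surjective_toLocSpanB N hN (r • l)
    exact ⟨r', h.symm⟩

end TwoAGLData

end LocalizationAtMaximal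

/-! ### From the setting to the fractional-ideal data -/

section Main

open IsLocalRing

variable {R : Type u} [CommRing R] [IsLocalRing R] (F : Type u) [CommRing F] [Algebra R F]
  [IsFractionRing R F] {I : Ideal R} {a : R}

/-- The isomorphism `I ≅ K`, `x ↦ x / a`. -/
theorem nonempty_equiv_fractionalK (ha : a ∈ R⁰) : Nonempty (I ≃ₗ[R] fractionalK F I ha) := by
  have hunit : IsLocalization.mk' F (1 : R) (⟨a, ha⟩ : R⁰) * algebraMap R F a = 1 := by
    rw [IsLocalization.mk'_spec, map_one]
  have hmem : ∀ x : I, (LinearMap.mulLeft R (IsLocalization.mk' F (1 : R) (⟨a, ha⟩ : R⁰)) ∘ₗ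
      Algebra.linearMap R F ∘ₗ I.subtype) x ∈ fractionalK F I ha := fun x =>
    Submodule.smul_mem_pointwise_smul _ _ _ (Submodule.mem_map_of_mem x.2)
  refine ⟨LinearEquiv.ofBijective (LinearMap.codRestrict _ _ hmem) ⟨?_, ?_⟩⟩
  · rw [injective_iff_map_eq_zero]
    intro x hx
    have h1 : IsLocalization.mk' F (1 : R) (⟨a, ha⟩ : R⁰) * algebraMap R F x = 0 :=
      congrArg Subtype.val hx
    ext
    apply IsFractionRing.injective R F
    rw [Submodule.coe_zero, map_zero, ← one_mul (algebraMap R F x), ← hunit, mul_right_comm, h1,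
      zero_mul]
  · rintro ⟨z, hz⟩
    obtain ⟨x, hx, rfl⟩ := (mem_fractionalK F I ha z).1 hz
    refine ⟨⟨x, hx⟩, Subtype.ext ?_⟩
    change IsLocalization.mk' F (1 : R) (⟨a, ha⟩ : R⁰) * algebraMap R F x = _
    rw [mul_comm, IsLocalization.mul_mk'_eq_mk'_of_mul, mul_one]

/-- The hypotheses of the main theorem in terms of fractional ideals. -/
theorem Setting.exists_twoAGLData (hS : Setting R I a) (h2 : IsTwoAGL I hS.regular)
    (hm : ∃ α ∈ maximalIdeal R, maximalIdeal R ^ 2 = Ideal.span {α} * maximalIdeal R) :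
    ∃ (S : Submodule R F) (α : R), TwoAGLData (fractionalK F I hS.regular) S α a := by
  have := hS.cohenMacaulay.noetherian
  have ha := hS.regular
  obtain ⟨n, hn⟩ := hS.reduction
  obtain ⟨α, hα, hm⟩ := hm
  have ham : a ∈ maximalIdeal R := le_maximalIdeal hS.ne_top hS.mem
  have hmul : ∀ x ∈ maximalIdeal R, ∀ y ∈ maximalIdeal R,
      ∃ z ∈ maximalIdeal R, x * y = α * z := by
    intro x hx y hy
    have h1 : x * y ∈ maximalIdeal R ^ 2 := by
      rw [sq]
      exact Ideal.mul_mem_mul hx hy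
    rw [hm, Ideal.mem_span_singleton_mul] at h1
    obtain ⟨z, hz, h⟩ := h1
    exact ⟨z, hz, h.symm⟩
  have h1 : (1 : F) ∈ fractionalK F I ha := one_mem_fractionalK ha hS.mem
  obtain ⟨e⟩ := nonempty_equiv_fractionalK F (I := I) ha
  have hfg : (fractionalK F I ha).FG :=
    Module.Finite.iff_fg.1 (Module.Finite.equiv e)
  refine ⟨fractionalK F I ha ^ n, α, ?_, ha, ham, ?_, ?_, hα, hmul, ?_, ?_, ?_, ?_, ?_⟩
  · exact isDualizing_of_isCanonicalModule ha ham hS.dim_one I hS.canonical h1 e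
  · exact fun c hc => isFiniteLength_quotient_span hS.dim_one hc
  -- `α` is regular because it divides the regular element `a²`.
  · obtain ⟨z, -, hz⟩ := hmul a ham a ham
    have h3 : α * z ∈ R⁰ := hz ▸ mul_mem ha ha
    exact (mul_mem_nonZeroDivisors.1 h3).1
  · have h3 := fractionalK_pow_le ha hS.mem hn 1 (F := F)
    rwa [pow_one] at h3
  · rw [← pow_add]
    exact fractionalK_pow_le ha hS.mem hn _
  · exact hfg.pow n
  · intro T hKT hT
    exact fractionalK_pow_le_of_mul_le ha n T (hKT h1) hKT hT
  · rw [← sallyRank_eq_relLength ha hS.mem hn]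
    exact h2

end Main

end TwoAGL

end

theorem theorem6p2 {R : Type u} [CommRing R] [IsLocalRing R]
    (F : Type u) [CommRing F] [Algebra R F] [IsFractionRing R F]
    (I : Ideal R) (a : R) (hS : TwoAGL.Setting R I a)
    (h2 : TwoAGL.IsTwoAGL I hS.regular)
    (hm : ∃ α ∈ IsLocalRing.maximalIdeal R,
      IsLocalRing.maximalIdeal R ^ 2 = Ideal.span {α} * IsLocalRing.maximalIdeal R) :
    Module.length R (TwoAGL.QuotL F I hS.regular) = 1 ∧
    (∃ _ : (TwoAGL.idealM F I hS.regular).IsMaximal,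
      Nonempty ((R ⧸ IsLocalRing.maximalIdeal R) ≃ₐ[R]
        (TwoAGL.algB (R := R) F ⧸ TwoAGL.idealM F I hS.regular)) ∧
      TwoAGL.IsAGL (Localization.AtPrime (TwoAGL.idealM F I hS.regular)) ∧
      ¬ TwoAGL.IsGorensteinLocalRing (Localization.AtPrime (TwoAGL.idealM F I hS.regular))) ∧
    (∀ (N : Ideal (TwoAGL.algB (R := R) F)) [N.IsMaximal], N ≠ TwoAGL.idealM F I hS.regular →
      TwoAGL.IsGorensteinLocalRing (Localization.AtPrime N)) ∧
    (∀ (N : Ideal (TwoAGL.algB (R := R) F)) [N.IsMaximal],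
      TwoAGL.IsAGL (Localization.AtPrime N)) := by
  have := hS.cohenMacaulay.noetherian
  obtain ⟨S, α, D⟩ := hS.exists_twoAGLData F h2 hm
  -- `moduleL` and `spanB` unfold to the same `B`-span of `K`.
  have hM : TwoAGL.idealM F I hS.regular = TwoAGL.annB (TwoAGL.fractionalK F I hS.regular) := rfl
  have hmax := D.isMaximal_annB.1
  rw [hM]
  exact ⟨D.length_quotSpanB, ⟨hmax, D.nonempty_algEquiv, D.isAGL_localization _,
    D.not_isGorensteinLocalRing_localization⟩,
    fun N _ hN => D.isGorensteinLocalRing_localization N hN, fun N _ => D.isAGL_localization N⟩
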